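/- Let $I=[0,1]$, and let $\mathrm{Aut}\,I$ be the group of orientation preserving (that is, increasing) homeomorphisms of $I$. For a simplicial set $X$, extended from $\Delta$ to the category of all non-empty finite linearly ordered sets (the extension is unique up to unique isomorphism), the geometric realization of $X$ is the set $$|X|=\varinjlim_{F} X(\pi_0(I\setminus F)),$$ where $F$ runs through the finite subsets of $I$ and the set $\pi_0(I\setminus F)$ of connected components carries the natural linear order. A $\mathbb Z_+$-category is a category in which every object $c$ carries an endomorphism $\mathbf 1_c$ such that $f\mathbf 1_{c_1}=\mathbf 1_{c_2}f$ for all $f:c_1\to c_2$; a $\mathbb Z_+$-functor is a functor $\Phi$ with $\Phi(\mathbf 1_c)=\mathbf 1_{\Phi(c)}$. The circle $S^1=\mathbb R/\mathbb Z$ is the $\mathbb Z_+$-category whose objects are its points, whose morphisms are the homotopy classes of paths which lift to nondecreasing paths in $\mathbb R$, and in which $\mathbf 1_x$ is the class of the path of degree $1$ from $x$ to $x$. Let $[n]_{\mathrm{cyc}}$ be the full subcategory of $S^1$ on the points $k/(n+1)$, $0\le k\le n$, let $\Lambda$ be the category whose objects are the $[n]_{\mathrm{cyc}}$, $n\ge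 0$, and whose morphisms are the $\mathbb Z_+$-functors, and let $\Lambda_{\mathrm{big}}$ be the category of all small $\mathbb Z_+$-categories that are $\mathbb Z_+$-isomorphic to some $[n]_{\mathrm{cyc}}$, with $\mathbb Z_+$-functors as morphisms. A cyclic set is a functor $X:\Lambda^{\circ}\to\mathrm{Sets}$; it extends, uniquely up to unique isomorphism, to $\Lambda_{\mathrm{big}}^{\circ}$. For a non-empty finite $F\subset S^1$ let $\pi_0(S^1\setminus F)\in\Lambda_{\mathrm{big}}$ be the $\mathbb Z_+$-category, with the connected components of $S^1\setminus F$ as objects, which is characterized by a $\mathbb Z_+$-functor $S^1\setminus F\to\pi_0(S^1\setminus F)$ whose restriction to any system of representatives of the components is an isomorphism. The geometric realization of a cyclic set $X$ is the set $$|X|=\varinjlim_{F} X(\pi_0(S^1\setminus F)),$$ where $F$ runs through the non-empty finite subsets of $S^1$. Let $\mathrm{Aut}\,S^1$ be the group of orientation preserving homeomorphisms of $S^1$, that is, those which lift to an increasing homeomorphism of $\mathbb R$. Then the following hold. 1. The group of automorphisms of the geometric realization functor from simplicial sets to sets is $\mathrm{Aut}\,I$. More precisely, $\mathrm{Aut}\,I$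 acts on this functor: $\varphi$ sends the class of $\xi\in X(\pi_0(I\setminus F))$ to the class of the image of $\xi$ under the map $X(\pi_0(I\setminus F))\to X(\pi_0(I\setminus\varphi(F)))$ induced by $\varphi^{-1}:I\setminus\varphi(F)\to I\setminus F$; and the resulting homomorphism from $\mathrm{Aut}\,I$ to the group of automorphisms of the functor is an isomorphism. Moreover, $\mathrm{Aut}\,I$ is the group of automorphisms of the ordered set $I$. 2. The group of automorphisms of the geometric realization functor from cyclic sets to sets is $\mathrm{Aut}\,S^1$: the analogous action, in which $\varphi$ sends the class of $\xi\in X(\pi_0(S^1\setminus F))$ to the class of its image under the map $X(\pi_0(S^1\setminus F))\to X(\pi_0(S^1\setminus\varphi(F)))$ induced by $\varphi^{-1}$, defines an isomorphism from $\mathrm{Aut}\,S^1$ to the group of automorphisms of the functor. -/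

import Mathlib

open CategoryTheory CategoryTheory.Limits

universe u

/-- Orientation preserving (i.e. increasing) homeomorphisms of `I = [0,1]`. -/
def AutI : Subgroup (unitInterval ≃ₜ unitInterval) where
  carrier := {φ | StrictMono φ}
  one_mem' := fun _ _ h => h
  mul_mem' := fun {a b} ha hb => fun _ _ h => ha (hb h)
  inv_mem' := fun {a} ha x y h => by
    have e : ∀ z, a (a⁻¹ z) = z := fun z => a.apply_symm_apply z
    rw [← ha.lt_iff_lt, e, e]
    exact h

/-- The complement `I \ F`, as a subspace of `I`. -/
abbrev IntervalCompl (F : Finset unitInterval) : Type := {x : unitInterval // x ∉ F}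

/-- The set `π₀(I \ F)` of connected components. -/
abbrev IntervalPi0 (F : Finset unitInterval) : Type := _root_.ConnectedComponents (IntervalCompl F)

namespace IntervalPi0

theorem mk_eq_of_forall {F : Finset unitInterval} {x y : IntervalCompl F} (hxy : x ≤ y)
    (h : ∀ f ∈ F, f < y.1 → f < x.1) : (x : IntervalPi0 F) = y := by
  have hs : _root_.IsPreconnected ((Subtype.val : IntervalCompl F → unitInterval) ⁻¹'
      (Set.Icc x.1 y.1)) := by
    have hsub : Set.Icc x.1 y.1 ⊆ Set.range (Subtype.val : IntervalCompl F → unitInterval) := by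
      intro z hz
      refine ⟨⟨z, fun hF => ?_⟩, rfl⟩
      rcases lt_or_eq_of_le hz.2 with h1 | h1
      · exact absurd (h z hF h1) (not_lt.2 hz.1)
      · exact y.2 (h1 ▸ hF)
    have hi : Topology.IsInducing (Subtype.val : IntervalCompl F → unitInterval) := ⟨rfl⟩
    rw [← hi.isPreconnected_image, Set.image_preimage_eq_of_subset hsub]
    exact isPreconnected_Icc
  rw [ConnectedComponents.coe_eq_coe']
  exact hs.subset_connectedComponent (x := y) ⟨hxy, le_rfl⟩ ⟨le_rfl, hxy⟩

theorem lt_iff_of_mk_eq {F : Finset unitInterval} {x y : IntervalCompl F}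
    (h : (x : IntervalPi0 F) = y) {f : unitInterval} (hf : f ∈ F) : f < x.1 ↔ f < y.1 := by
  have hcl : IsClopen {z : IntervalCompl F | f < z.1} := by
    constructor
    · have : {z : IntervalCompl F | f < z.1} = {z : IntervalCompl F | f ≤ z.1} := by
        ext z
        exact ⟨fun h : f < z.1 => (le_of_lt h : f ≤ z.1),
          fun h : f ≤ z.1 => lt_of_le_of_ne h fun e : f = z.1 => z.2 (e ▸ hf)⟩
      rw [this]
      exact isClosed_le continuous_const continuous_subtype_val
    · exact isOpen_lt continuous_const continuous_subtype_val
  rw [ConnectedComponents.coe_eq_coe'] at h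
  constructor
  · intro hx
    exact (hcl.connectedComponent_subset hx) (ConnectedComponents.coe_eq_coe'.1
      (ConnectedComponents.coe_eq_coe'.2 h).symm)
  · intro hy
    exact (hcl.connectedComponent_subset hy) h

/-- The natural order: `a ≤ b` if some point of `a` lies before some point of `b`. -/
noncomputable instance (F : Finset unitInterval) : LinearOrder (IntervalPi0 F) where
  le a b := ∃ x y : IntervalCompl F, (x : IntervalPi0 F) = a ∧ (y : IntervalPi0 F) = b ∧ x ≤ y
  le_refl a := by
    obtain ⟨x, rfl⟩ := ConnectedComponents.surjective_coe a
    exact ⟨x, x, rfl, rfl, le_rfl⟩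
  le_trans := by
    rintro a b c ⟨x, y, rfl, rfl, hxy⟩ ⟨y', z, hy, rfl, hyz⟩
    rcases le_total x z with h | h
    · exact ⟨x, z, rfl, rfl, h⟩
    · have : (z : IntervalPi0 F) = x := mk_eq_of_forall h fun f hf hfx =>
        lt_of_lt_of_le ((lt_iff_of_mk_eq hy hf).2 (lt_of_lt_of_le hfx hxy)) hyz
      exact ⟨x, x, rfl, this.symm, le_rfl⟩
  le_antisymm := by
    rintro a b ⟨x, y, rfl, rfl, hxy⟩ ⟨y', x', hy, hx, hyx⟩
    exact mk_eq_of_forall hxy fun f hf hfy =>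
      (lt_iff_of_mk_eq hx hf).1 (lt_of_lt_of_le ((lt_iff_of_mk_eq hy hf).2 hfy) hyx)
  le_total a b := by
    obtain ⟨x, rfl⟩ := ConnectedComponents.surjective_coe a
    obtain ⟨y, rfl⟩ := ConnectedComponents.surjective_coe b
    rcases le_total x y with h | h
    · exact Or.inl ⟨x, y, rfl, rfl, h⟩
    · exact Or.inr ⟨y, x, rfl, rfl, h⟩
  toDecidableLE := Classical.decRel _

instance (F : Finset unitInterval) : Finite (IntervalPi0 F) := by
  classical
  have hinj : Function.Injective (fun a : IntervalPi0 F =>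
      (⟨F.filter (fun f => f < (Quot.out a : IntervalCompl F).1), Finset.filter_subset _ _⟩ :
        {s : Finset unitInterval // s ⊆ F})) := by
    intro a b hab
    have hab' : ∀ f ∈ F, (f < (Quot.out a : IntervalCompl F).1 ↔
        f < (Quot.out b : IntervalCompl F).1) := by
      intro f hf
      have := congrArg (fun s => f ∈ s.1) hab
      simpa [hf] using this
    have ha : ((Quot.out a : IntervalCompl F) : IntervalPi0 F) = a := Quot.out_eq a
    have hb : ((Quot.out b : IntervalCompl F) : IntervalPi0 F) = b := Quot.out_eq b
    rw [← ha, ← hb]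
    rcases le_total (Quot.out a : IntervalCompl F) (Quot.out b) with h | h
    · exact mk_eq_of_forall h fun f hf h' => (hab' f hf).2 h'
    · exact (mk_eq_of_forall h fun f hf h' => (hab' f hf).1 h').symm
  have : Finite {s : Finset unitInterval // s ⊆ F} :=
    Finite.of_equiv {s // s ∈ F.powerset} (Equiv.subtypeEquivRight fun s => Finset.mem_powerset)
  exact Finite.of_injective _ hinj

instance (F : Finset unitInterval) : Nonempty (IntervalPi0 F) := by
  obtain ⟨x, hx⟩ := (Set.infinite_univ_iff.1 (by
    have := (Set.Icc_infinite (zero_lt_one (α := ℝ))); exact Set.infinite_univ_iff.2 this.to_subtype) : Infinite unitInterval).exists_notMem_finset F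
  exact ⟨((⟨x, hx⟩ : IntervalCompl F) : IntervalPi0 F)⟩

noncomputable instance (F : Finset unitInterval) : Fintype (IntervalPi0 F) := Fintype.ofFinite _

/-- `π₀(I \ F)` as a non-empty finite linearly ordered set. -/
noncomputable def obj (F : Finset unitInterval) : NonemptyFinLinOrd.{0} :=
  NonemptyFinLinOrd.of (IntervalPi0 F)

/-- The map `π₀(I \ G) → π₀(I \ F)` induced by `ψ ∈ Aut I` with `ψ (I \ G) ⊆ I \ F`. -/
noncomputable def map (ψ : AutI) {G F : Finset unitInterval}
    (h : ∀ x, x ∉ G → ψ.1 x ∉ F) : obj G ⟶ obj F :=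
  NonemptyFinLinOrd.ofHom
    { toFun := Continuous.connectedComponentsMap
        (f := fun x : IntervalCompl G => (⟨ψ.1 x.1, h x.1 x.2⟩ : IntervalCompl F))
        ((ψ.1.continuous.comp continuous_subtype_val).subtype_mk _)
      monotone' := by
        rintro a b ⟨x, y, rfl, rfl, hxy⟩
        exact ⟨⟨ψ.1 x.1, h x.1 x.2⟩, ⟨ψ.1 y.1, h y.1 y.2⟩, rfl, rfl, ψ.2.monotone hxy⟩ }

theorem map_one (F : Finset unitInterval) (h : ∀ x, x ∉ F → (1 : AutI).1 x ∉ F) :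
    map 1 h = 𝟙 (obj F) := by
  ext a
  obtain ⟨x, rfl⟩ := ConnectedComponents.surjective_coe a
  rfl

theorem map_comp (ψ ψ' : AutI) {G F E : Finset unitInterval} (h : ∀ x, x ∉ G → ψ.1 x ∉ F)
    (h' : ∀ x, x ∉ F → ψ'.1 x ∉ E) (h'' : ∀ x, x ∉ G → (ψ' * ψ).1 x ∉ E) :
    map ψ h ≫ map ψ' h' = map (ψ' * ψ) h'' := by
  ext a
  obtain ⟨x, rfl⟩ := ConnectedComponents.surjective_coe a
  rfl

end IntervalPi0

/-- The system `F ↦ π₀(I \ F)`, indexed by the finite subsets of `I`; for `F ⊆ G` the transition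
map is the canonical map `π₀(I \ G) → π₀(I \ F)`. -/
noncomputable def intervalDiagram : Finset unitInterval ⥤ NonemptyFinLinOrd.{0}ᵒᵖ where
  obj F := Opposite.op (IntervalPi0.obj F)
  map {F G} i := (IntervalPi0.map 1 (G := G) (F := F) fun x hx hF => hx (leOfHom i hF)).op
  map_id F := by rw [IntervalPi0.map_one]; rfl
  map_comp {F G H} i j := by
    rw [← op_comp, IntervalPi0.map_comp]
    rfl

namespace SSet

/-- The extension of a simplicial set to the category of all non-empty finite linearly ordered
sets. -/
noncomputable def extend (X : SSet.{u}) : NonemptyFinLinOrd.{0}ᵒᵖ ⥤ Type u :=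
  SimplexCategory.skeletalEquivalence.inverse.op ⋙ X

/-- The geometric realization functor from simplicial sets to sets,
`|X| = colim_F X(π₀(I \ F))`. -/
noncomputable def setRealization : SSet.{u} ⥤ Type u :=
  (Functor.whiskeringLeft _ _ (Type u)).obj
    (intervalDiagram ⋙ SimplexCategory.skeletalEquivalence.inverse.op) ⋙ colim

/-- The canonical map `X(π₀(I \ F)) → |X|`. -/
noncomputable def setRealizationι (X : SSet.{u}) (F : Finset unitInterval) :
    X.extend.obj (Opposite.op (IntervalPi0.obj F)) ⟶ setRealization.obj X :=
  colimit.ι (intervalDiagram ⋙ X.extend) F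

end SSet

/-! ### `ℤ₊`-categories -/

/-- A structure of `ℤ₊`-category: an endomorphism `1_c` of every object, commuting with all
morphisms. -/
class ZPlusCategory (C : Type*) [Category C] where
  one : ∀ c : C, c ⟶ c
  one_comm : ∀ {c c' : C} (f : c ⟶ c'), one c ≫ f = f ≫ one c'

/-- A full subcategory of a `ℤ₊`-category is a `ℤ₊`-category. -/
instance {ι : Type*} {C : Type*} [Category C] [ZPlusCategory C] (p : ι → C) :
    ZPlusCategory (InducedCategory C p) where
  one c := InducedCategory.homMk (ZPlusCategory.one (p c))
  one_comm f := InducedCategory.hom_ext (ZPlusCategory.one_comm f.hom)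

/-- A small `ℤ₊`-category. -/
structure ZPlusCat where
  carrier : Type
  [cat : SmallCategory carrier]
  [zplus : ZPlusCategory carrier]

namespace ZPlusCat

attribute [instance] ZPlusCat.cat ZPlusCat.zplus

/-- A `ℤ₊`-functor. -/
@[ext]
structure Hom (C D : ZPlusCat) where
  functor : C.carrier ⥤ D.carrier
  map_one : ∀ c, functor.map (ZPlusCategory.one c) = ZPlusCategory.one (functor.obj c)

/-- The category of small `ℤ₊`-categories and `ℤ₊`-functors; its isomorphisms are the
`ℤ₊`-isomorphisms. -/
instance : Category ZPlusCat where
  Hom := Hom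
  id C := ⟨𝟭 _, fun _ => rfl⟩
  comp F G := ⟨F.functor ⋙ G.functor, fun c => by
    rw [Functor.comp_map, F.map_one, G.map_one]; rfl⟩

end ZPlusCat

/-! ### The circle as a `ℤ₊`-category -/

namespace CirclePath

/-- A homotopy class of paths in `ℝ/ℤ` is oriented if it contains a path which can be represented
as a composition `I → ℝ → ℝ/ℤ` whose first map is nondecreasing. -/
def IsOriented {x y : UnitAddCircle} (p : Path.Homotopic.Quotient x y) : Prop :=
  ∃ γ : Path x y, Path.Homotopic.Quotient.mk γ = p ∧
    ∃ f : unitInterval → ℝ, Continuous f ∧ Monotone f ∧ ∀ t, γ t = (f t : UnitAddCircle)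

theorem exists_lift {x y : UnitAddCircle} (γ : Path x y) (a : ℝ) (ha : (a : UnitAddCircle) = x) :
    ∃ (b : ℝ) (Γ : Path a b), ∀ t, γ t = (Γ t : UnitAddCircle) := by
  have cov := AddCircle.isCoveringMap_coe (1 : ℝ)
  have h0 : γ.toContinuousMap 0 = (a : UnitAddCircle) := by rw [ha]; exact γ.source
  refine ⟨_, ⟨cov.liftPath γ.toContinuousMap a h0, cov.liftPath_zero .., rfl⟩, fun t => ?_⟩
  exact (congrFun (cov.liftPath_lifts γ.toContinuousMap a h0) t).symm

theorem exists_base (x : UnitAddCircle) : ∃ a : ℝ, (a : UnitAddCircle) = x :=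
  QuotientAddGroup.mk_surjective x

theorem coe_eq_coe {a b : ℝ} (h : (a : UnitAddCircle) = b) : ∃ n : ℤ, b = a + n := by
  obtain ⟨n, hn⟩ := AddCircle.coe_eq_zero_iff (p := (1 : ℝ)) (x := b - a) |>.1 (by
    rw [AddCircle.coe_sub, h, sub_self])
  exact ⟨n, by simp at hn; linarith⟩

theorem coe_add_int (a : ℝ) (n : ℤ) : ((a + n : ℝ) : UnitAddCircle) = a := by
  rw [AddCircle.coe_add, (AddCircle.coe_eq_zero_iff (p := (1 : ℝ)) (x := n)).2 ⟨n, by simp⟩,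
    add_zero]

/-- The total displacement `Γ 1 - Γ 0` of a lift `Γ` to `ℝ` of a class of paths in `ℝ/ℤ`. -/
noncomputable def disp {x y : UnitAddCircle} (p : Path.Homotopic.Quotient x y) : ℝ :=
  ((AddCircle.isCoveringMap_coe (1 : ℝ)).monodromy p
    ⟨(exists_base x).choose, (exists_base x).choose_spec⟩).1 - (exists_base x).choose

theorem disp_mk {x y : UnitAddCircle} (γ : Path x y) {a b : ℝ} (Γ : Path a b)
    (h : ∀ t, γ t = (Γ t : UnitAddCircle)) : disp (Path.Homotopic.Quotient.mk γ) = b - a := by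
  have cov := AddCircle.isCoveringMap_coe (1 : ℝ)
  have hc := (exists_base x).choose_spec
  set c := (exists_base x).choose with hcdef
  have hx : (a : UnitAddCircle) = c := by
    rw [hc, ← γ.source, h 0, Γ.source]
  obtain ⟨n, hn⟩ := coe_eq_coe hx
  have h0 : γ.toContinuousMap 0 = (c : UnitAddCircle) := by rw [hc]; exact γ.source
  have key := (cov.eq_liftPath_iff' (γ := γ.toContinuousMap) (e := c) (γ_0 := h0)
    (Γ := ⟨fun t => Γ t + n, by fun_prop⟩)).2 ⟨by
      funext t
      change ((Γ t + n : ℝ) : UnitAddCircle) = γ t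
      rw [coe_add_int, h t], by
      change Γ 0 + n = c
      rw [Γ.source, hn]⟩
  have h1 : disp (Path.Homotopic.Quotient.mk γ) = cov.liftPath γ.toContinuousMap c h0 1 - c := rfl
  rw [h1, ← key]
  change Γ 1 + n - c = _
  rw [Γ.target, hn]
  ring

theorem exists_rep {x y : UnitAddCircle} (p : Path.Homotopic.Quotient x y) (a : ℝ)
    (ha : (a : UnitAddCircle) = x) :
    ∃ (γ : Path x y) (Γ : Path a (a + disp p)), Path.Homotopic.Quotient.mk γ = p ∧
      ∀ t, γ t = (Γ t : UnitAddCircle) := by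
  obtain ⟨γ, rfl⟩ := Path.Homotopic.Quotient.mk_surjective p
  obtain ⟨b, Γ, h⟩ := exists_lift γ a ha
  exact ⟨γ, Γ.cast rfl (by rw [disp_mk γ Γ h]; ring), rfl, h⟩

theorem coe_add_disp {x y : UnitAddCircle} (p : Path.Homotopic.Quotient x y) :
    x + (disp p : UnitAddCircle) = y := by
  obtain ⟨a, ha⟩ := exists_base x
  obtain ⟨γ, Γ, -, h⟩ := exists_rep p a ha
  have := h 1
  rw [γ.target, Γ.target] at this
  rw [AddCircle.coe_add, ha] at this
  exact this.symm

theorem disp_injective {x y : UnitAddCircle} {p q : Path.Homotopic.Quotient x y}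
    (h : disp p = disp q) : p = q := by
  obtain ⟨a, ha⟩ := exists_base x
  obtain ⟨γ, Γ, rfl, hγ⟩ := exists_rep p a ha
  obtain ⟨γ', Γ', rfl, hγ'⟩ := exists_rep q a ha
  rw [Path.Homotopic.Quotient.eq]
  obtain ⟨H⟩ := SimplyConnectedSpace.paths_homotopic Γ (Γ'.cast rfl (by rw [h]))
  have H' := H.map (⟨fun r : ℝ => (r : UnitAddCircle), AddCircle.continuous_mk' 1⟩ : C(ℝ, UnitAddCircle))
  have hy : ((a + disp (Path.Homotopic.Quotient.mk γ) : ℝ) : UnitAddCircle) = y := by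
    rw [AddCircle.coe_add, ha, coe_add_disp]
  exact ⟨(H'.pathCast ha.symm hy.symm).cast (by ext t; exact (hγ t).symm) (by ext t; exact (hγ' t).symm)⟩

theorem disp_refl (x : UnitAddCircle) : disp (Path.Homotopic.Quotient.refl x) = 0 := by
  obtain ⟨a, ha⟩ := exists_base x
  rw [← Path.Homotopic.Quotient.mk_refl, disp_mk (Path.refl x) (Path.refl a) fun t => ha.symm,
    sub_self]

theorem disp_trans {x y z : UnitAddCircle} (p : Path.Homotopic.Quotient x y)
    (q : Path.Homotopic.Quotient y z) : disp (p.trans q) = disp p + disp q := by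
  obtain ⟨a, ha⟩ := exists_base x
  obtain ⟨γ, Γ, hp, hγ⟩ := exists_rep p a ha
  obtain ⟨γ', Γ', hq, hγ'⟩ := exists_rep q (a + disp p) (by rw [AddCircle.coe_add, ha, coe_add_disp])
  have : disp (p.trans q) = a + disp p + disp q - a := by
    conv_lhs => rw [← hp, ← hq, ← Path.Homotopic.Quotient.mk_trans]
    refine disp_mk _ (Γ.trans Γ') fun t => ?_
    rw [Path.trans_apply, Path.trans_apply]
    split_ifs
    · exact hγ _
    · exact hγ' _
  rw [this]
  ring

theorem disp_symm {x y : UnitAddCircle} (p : Path.Homotopic.Quotient x y) :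
    disp p.symm = - disp p := by
  have h := disp_trans p p.symm
  rw [Path.Homotopic.Quotient.trans_symm, disp_refl] at h
  linarith

theorem exists_disp {x y : UnitAddCircle} {d : ℝ} (h : x + (d : UnitAddCircle) = y) :
    ∃ p : Path.Homotopic.Quotient x y, disp p = d := by
  obtain ⟨a, ha⟩ := exists_base x
  let Γ : Path a (a + d) :=
    { toFun := fun t => a + t * d
      continuous_toFun := by fun_prop
      source' := by simp
      target' := by simp }
  let γ : Path x y :=
    { toFun := fun t => (Γ t : UnitAddCircle)
      continuous_toFun := (AddCircle.continuous_mk' 1).comp Γ.continuous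
      source' := by rw [Γ.source, ha]
      target' := by rw [Γ.target, AddCircle.coe_add, ha, h] }
  exact ⟨Path.Homotopic.Quotient.mk γ, by rw [disp_mk γ Γ fun t => rfl]; ring⟩

theorem isOriented_iff {x y : UnitAddCircle} (p : Path.Homotopic.Quotient x y) :
    IsOriented p ↔ 0 ≤ disp p := by
  constructor
  · rintro ⟨γ, rfl, f, hf, hm, h⟩
    rw [disp_mk γ (⟨⟨f, hf⟩, rfl, rfl⟩ : Path (f 0) (f 1)) h]
    exact sub_nonneg.2 (hm zero_le_one)
  · intro h0
    obtain ⟨a, ha⟩ := exists_base x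
    let γ : Path x y :=
      { toFun := fun t => ((a + t * disp p : ℝ) : UnitAddCircle)
        continuous_toFun := (AddCircle.continuous_mk' 1).comp (by fun_prop)
        source' := by simp [ha]
        target' := by
          have := coe_add_disp p
          simpa [ha] using this }
    refine ⟨γ, disp_injective ?_, fun t => a + t * disp p, by fun_prop, ?_, fun t => rfl⟩
    · let Γ : Path a (a + disp p) :=
        { toFun := fun t => a + t * disp p
          continuous_toFun := by fun_prop
          source' := by simp
          target' := by simp }
      rw [disp_mk γ Γ fun t => rfl]
      ring
    · intro s t hst
      have : (s : ℝ) ≤ t := hst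
      exact add_le_add le_rfl (mul_le_mul_of_nonneg_right this h0)

end CirclePath

/-- The circle `S¹ = ℝ/ℤ`, regarded as the set of objects of a category. -/
structure OrientedCircle where
  pt : UnitAddCircle

namespace OrientedCircle

open CirclePath

/-- Morphisms are homotopy classes of oriented paths. -/
noncomputable instance : SmallCategory OrientedCircle where
  Hom x y := {p : Path.Homotopic.Quotient x.pt y.pt // IsOriented p}
  id x := ⟨Path.Homotopic.Quotient.refl x.pt, by rw [isOriented_iff, disp_refl]⟩
  comp f g := ⟨f.1.trans g.1, by
    rw [isOriented_iff, disp_trans]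
    exact add_nonneg ((isOriented_iff _).1 f.2) ((isOriented_iff _).1 g.2)⟩
  id_comp f := Subtype.ext (Path.Homotopic.Quotient.refl_trans f.1)
  comp_id f := Subtype.ext (Path.Homotopic.Quotient.trans_refl f.1)
  assoc f g h := Subtype.ext (Path.Homotopic.Quotient.trans_assoc f.1 g.1 h.1)

theorem disp_comp {x y z : OrientedCircle} (f : x ⟶ y) (g : y ⟶ z) :
    disp (f ≫ g).1 = disp f.1 + disp g.1 := disp_trans f.1 g.1

theorem disp_id (x : OrientedCircle) : disp (𝟙 x : x ⟶ x).1 = 0 := disp_refl x.pt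

theorem hom_ext {x y : OrientedCircle} {f g : x ⟶ y} (h : disp f.1 = disp g.1) : f = g :=
  Subtype.ext (disp_injective h)

theorem disp_eqToHom {x y : OrientedCircle} (h : x = y) : disp (eqToHom h).1 = 0 := by
  subst h
  exact disp_id x

theorem disp_nonneg {x y : OrientedCircle} (f : x ⟶ y) : 0 ≤ disp f.1 := (isOriented_iff _).1 f.2

theorem coe_add_disp {x y : OrientedCircle} (f : x ⟶ y) :
    x.pt + (disp f.1 : UnitAddCircle) = y.pt := CirclePath.coe_add_disp f.1

theorem exists_hom {x y : OrientedCircle} {d : ℝ} (hd : 0 ≤ d)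
    (h : x.pt + (d : UnitAddCircle) = y.pt) : ∃ f : x ⟶ y, disp f.1 = d := by
  obtain ⟨p, hp⟩ := exists_disp h
  exact ⟨⟨p, (isOriented_iff p).2 (hp ▸ hd)⟩, hp⟩

/-- The path `t ↦ x + t` of degree `1` from `x` to `x`. -/
def fullTurn (x : UnitAddCircle) : Path x x where
  toFun t := x + ((t : ℝ) : UnitAddCircle)
  continuous_toFun := continuous_const.add ((AddCircle.continuous_mk' 1).comp (by fun_prop))
  source' := by simp
  target' := by simp

theorem disp_fullTurn (x : UnitAddCircle) : disp (Path.Homotopic.Quotient.mk (fullTurn x)) = 1 := by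
  obtain ⟨a, ha⟩ := exists_base x
  let Γ : Path a (a + 1) :=
    { toFun := fun t => a + t
      continuous_toFun := by fun_prop
      source' := by simp
      target' := by simp }
  have h : ∀ t, fullTurn x t = (Γ t : UnitAddCircle) := fun t => by
    change x + ((t : ℝ) : UnitAddCircle) = ((a + t : ℝ) : UnitAddCircle)
    rw [AddCircle.coe_add, ha]
  rw [disp_mk _ Γ h]
  ring

/-- `1_x` is the homotopy class of the path of degree `1` from `x` to `x`. -/
noncomputable instance : ZPlusCategory OrientedCircle where
  one x := ⟨Path.Homotopic.Quotient.mk (fullTurn x.pt), by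
    rw [isOriented_iff, disp_fullTurn]
    exact zero_le_one⟩
  one_comm {x y} f := hom_ext (by
    rw [disp_comp, disp_comp, disp_fullTurn, disp_fullTurn, add_comm])

theorem disp_one (x : OrientedCircle) : disp (ZPlusCategory.one x : x ⟶ x).1 = 1 :=
  disp_fullTurn x.pt

end OrientedCircle

/-- The full subcategory of the `ℤ₊`-category `S¹` formed by a family of points. -/
noncomputable abbrev circleSub {ι : Type} (p : ι → OrientedCircle) : ZPlusCat :=
  ⟨InducedCategory OrientedCircle p⟩

namespace circleSub

open CirclePath

/-- Displacement of a morphism of `circleSub p`. -/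
noncomputable def disp {ι : Type} {p : ι → OrientedCircle} {i j : (circleSub p).carrier}
    (f : i ⟶ j) : ℝ := CirclePath.disp f.hom.1

variable {ι : Type} {p : ι → OrientedCircle}

theorem disp_comp {i j k : (circleSub p).carrier} (f : i ⟶ j) (g : j ⟶ k) :
    disp (f ≫ g) = disp f + disp g := OrientedCircle.disp_comp f.hom g.hom

theorem disp_id (i : (circleSub p).carrier) : disp (𝟙 i) = 0 := OrientedCircle.disp_id (p i)

theorem disp_one (i : (circleSub p).carrier) : disp (ZPlusCategory.one i) = 1 :=
  OrientedCircle.disp_one (p i)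

theorem hom_ext {i j : (circleSub p).carrier} {f g : i ⟶ j} (h : disp f = disp g) : f = g :=
  InducedCategory.hom_ext (OrientedCircle.hom_ext h)

theorem disp_nonneg {i j : (circleSub p).carrier} (f : i ⟶ j) : 0 ≤ disp f :=
  OrientedCircle.disp_nonneg f.hom

theorem coe_add_disp {i j : (circleSub p).carrier} (f : i ⟶ j) :
    (p i).pt + (disp f : UnitAddCircle) = (p j).pt := OrientedCircle.coe_add_disp f.hom

theorem exists_hom {i j : (circleSub p).carrier} {d : ℝ} (hd : 0 ≤ d)
    (h : (p i).pt + (d : UnitAddCircle) = (p j).pt) : ∃ f : i ⟶ j, disp f = d := by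
  obtain ⟨f, hf⟩ := OrientedCircle.exists_hom (x := p i) (y := p j) hd h
  exact ⟨InducedCategory.homMk f, hf⟩

theorem disp_eqToHom {i j : (circleSub p).carrier} (h : i = j) : disp (eqToHom h) = 0 := by
  subst h
  exact disp_id i

theorem functor_ext {C : ZPlusCat} {F G : C ⟶ circleSub p}
    (hobj : ∀ c, F.functor.obj c = G.functor.obj c)
    (hmap : ∀ {c c' : C.carrier} (f : c ⟶ c'),
      disp (F.functor.map f) = disp (G.functor.map f)) : F = G := by
  refine ZPlusCat.Hom.ext (CategoryTheory.Functor.ext hobj fun c c' f => hom_ext ?_)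
  rw [disp_comp, disp_comp, disp_eqToHom, disp_eqToHom, hmap]
  ring

theorem exists_orderMap {κ : Type} {q : κ → OrientedCircle} (a : ι → ℝ) (b : κ → ℝ)
    (ha : ∀ i, (a i : UnitAddCircle) = (p i).pt) (hb : ∀ k, (b k : UnitAddCircle) = (q k).pt)
    (ha1 : ∀ i, a i ∈ Set.Ico (0 : ℝ) 1) (hb1 : ∀ k, b k ∈ Set.Ico (0 : ℝ) 1)
    (σ : ι → κ) (hσ : ∀ i j, a i ≤ a j → b (σ i) ≤ b (σ j)) :
    ∃ F : circleSub p ⟶ circleSub q, (∀ i, F.functor.obj i = σ i) ∧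
      ∀ {i j : (circleSub p).carrier} (f : i ⟶ j), disp (F.functor.map f) =
        disp f - (a j - a i) + (b (F.functor.obj j) - b (F.functor.obj i)) := by
  have key : ∀ {i j : (circleSub p).carrier} (f : i ⟶ j),
      ∃ g : (show (circleSub q).carrier from σ i) ⟶ (show (circleSub q).carrier from σ j),
        disp g = disp f - (a j - a i) + (b (σ j) - b (σ i)) := by
    intro i j f
    have hc := coe_add_disp f
    rw [← ha i, ← ha j, ← AddCircle.coe_add] at hc
    obtain ⟨n, hn⟩ := coe_eq_coe hc
    have hd := disp_nonneg f
    have e : disp f - (a j - a i) = -n := by linarith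
    have hai := ha1 i
    have haj := ha1 j
    have hbi := hb1 (σ i)
    have hbj := hb1 (σ j)
    simp only [Set.mem_Ico] at hai haj hbi hbj
    refine exists_hom ?_ ?_
    · rw [e]
      have hn0 : n ≤ 0 := by
        have : (n : ℝ) < 1 := by linarith
        have : n < 1 := by exact_mod_cast this
        omega
      rcases hn0.lt_or_eq with h | h
      · have : n ≤ -1 := by omega
        have : (n : ℝ) ≤ -1 := by exact_mod_cast this
        linarith
      · subst h
        have := hσ i j (by simp at hn; linarith)
        simp
        linarith
    · rw [← hb, ← hb, ← AddCircle.coe_add, e]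
      rw [show b (σ i) + (-(n : ℝ) + (b (σ j) - b (σ i))) = b (σ j) + ((-n : ℤ) : ℝ) by
        push_cast; ring, coe_add_int]
  refine ⟨⟨{ obj := σ
             map := fun f => (key f).choose
             map_id := fun i => hom_ext ?_
             map_comp := fun f g => hom_ext ?_ }, fun i => hom_ext ?_⟩, fun i => rfl, fun f => ?_⟩
  · rw [(key _).choose_spec, disp_id, disp_id]; ring
  · refine (key (f ≫ g)).choose_spec.trans (Eq.trans ?_ (disp_comp _ _).symm)
    rw [(key f).choose_spec, (key g).choose_spec, disp_comp]
    ring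
  · change disp (key _).choose = _
    rw [(key _).choose_spec, disp_one, disp_one]; ring
  · exact (key _).choose_spec

theorem nonempty_iso {κ : Type} {q : κ → OrientedCircle} (a : ι → ℝ) (b : κ → ℝ)
    (ha : ∀ i, (a i : UnitAddCircle) = (p i).pt) (hb : ∀ k, (b k : UnitAddCircle) = (q k).pt)
    (ha1 : ∀ i, a i ∈ Set.Ico (0 : ℝ) 1) (hb1 : ∀ k, b k ∈ Set.Ico (0 : ℝ) 1)
    (σ : ι ≃ κ) (hσ : ∀ i j, a i ≤ a j ↔ b (σ i) ≤ b (σ j)) :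
    Nonempty (circleSub p ≅ circleSub q) := by
  obtain ⟨F, hF, hF'⟩ := exists_orderMap a b ha hb ha1 hb1 σ fun i j => (hσ i j).1
  obtain ⟨G, hG, hG'⟩ := exists_orderMap b a hb ha hb1 ha1 σ.symm fun i j h =>
    (hσ _ _).2 (by simpa using h)
  have h1 : ∀ i, G.functor.obj (F.functor.obj i) = i := fun i => by
    exact (hG _).trans ((congrArg σ.symm (hF i)).trans (σ.symm_apply_apply i))
  have h2 : ∀ k, F.functor.obj (G.functor.obj k) = k := fun k => by
    exact (hF _).trans ((congrArg σ (hG k)).trans (σ.apply_symm_apply k))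
  refine ⟨⟨F, G, functor_ext h1 fun f => ?_, functor_ext h2 fun f => ?_⟩⟩
  · change disp (G.functor.map (F.functor.map f)) = disp f
    rw [hG', hF', h1, h1]; ring
  · change disp (F.functor.map (G.functor.map f)) = disp f
    rw [hF', hG', h2, h2]; ring

end circleSub

/-! ### The cyclic category -/

/-- `[n]_cyc`: the set `{0, …, n}`, embedded in `S¹` by `k ↦ k / (n + 1)`, with the structure of
`ℤ₊`-category induced from `S¹`. -/
noncomputable def cyc (n : ℕ) : ZPlusCat :=
  circleSub fun k : Fin (n + 1) => ⟨((k / (n + 1) : ℝ) : UnitAddCircle)⟩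

/-- Connes' cyclic category `Λ`: its objects are the `[n]_cyc`, its morphisms are the
`ℤ₊`-functors. -/
abbrev CyclicCategory : Type := InducedCategory ZPlusCat cyc

/-- The property of being `ℤ₊`-isomorphic to some `[n]_cyc`. -/
def isCyc : ObjectProperty ZPlusCat := fun C => ∃ n, Nonempty (C ≅ cyc n)

/-- The category `Λ_big` of all `ℤ₊`-categories which are `ℤ₊`-isomorphic to some `[n]_cyc`. -/
abbrev BigCyclicCategory : Type 1 := isCyc.FullSubcategory

/-- The inclusion of `Λ` in `Λ_big`. -/
noncomputable def cyclicInclusion : CyclicCategory ⥤ BigCyclicCategory :=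
  isCyc.lift (inducedFunctor cyc) fun n => ⟨n, ⟨Iso.refl _⟩⟩

instance : cyclicInclusion.Full where
  map_surjective f := ⟨InducedCategory.homMk f.hom, rfl⟩

instance : cyclicInclusion.Faithful where
  map_injective h := InducedCategory.hom_ext (congrArg (fun f => f.hom) h)

instance : cyclicInclusion.EssSurj where
  mem_essImage C := by
    obtain ⟨n, ⟨e⟩⟩ := C.2
    exact ⟨n, ⟨isCyc.isoMk e.symm⟩⟩

instance : cyclicInclusion.IsEquivalence where

theorem isCyc_circleSub {ι : Type} [Finite ι] [Nonempty ι] (p : ι → OrientedCircle)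
    (hp : Function.Injective p) : isCyc (circleSub p) := by
  classical
  have hex : ∀ i, ∃ a : ℝ, (a : UnitAddCircle) = (p i).pt ∧ a ∈ Set.Ico (0 : ℝ) 1 := fun i => by
    have h : (p i).pt ∈ ((↑) : ℝ → UnitAddCircle) '' Set.Ico 0 (0 + 1) := by
      rw [AddCircle.coe_image_Ico_eq]; trivial
    obtain ⟨a, ha, h⟩ := h
    exact ⟨a, h, by simpa using ha⟩
  choose a ha ha1 using hex
  have hinj : Function.Injective a := fun i j h => hp (by
    have : (p i).pt = (p j).pt := by rw [← ha, ← ha, h]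
    cases hi : p i
    cases hj : p j
    simpa [hi, hj] using this)
  let : LinearOrder ι := LinearOrder.lift' a hinj
  let := Fintype.ofFinite ι
  obtain ⟨n, hn⟩ : ∃ n, Fintype.card ι = n + 1 :=
    ⟨Fintype.card ι - 1, by have := Fintype.card_pos (α := ι); omega⟩
  let σ : Fin (n + 1) ≃o ι := monoEquivOfFin ι hn
  have hn0 : (0 : ℝ) < n + 1 := by positivity
  refine ⟨n, circleSub.nonempty_iso a (fun k : Fin (n + 1) => (k / (n + 1) : ℝ)) ha
    (fun k => rfl) ha1 (fun k => ⟨by positivity, ?_⟩) σ.symm.toEquiv fun i j => ?_⟩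
  · rw [div_lt_one hn0]
    exact_mod_cast k.2
  · rw [div_le_div_iff_of_pos_right hn0, Nat.cast_le]
    exact (σ.symm.le_iff_le (x := i) (y := j)).symm

/-! ### `Aut S¹` -/

/-- Orientation preserving homeomorphisms of `S¹ = ℝ/ℤ`: those which lift to an increasing
homeomorphism of `ℝ`. -/
def AutCircle : Subgroup (UnitAddCircle ≃ₜ UnitAddCircle) where
  carrier := {φ | ∃ f : ℝ ≃o ℝ, ∀ x : ℝ, φ x = (f x : UnitAddCircle)}
  one_mem' := ⟨OrderIso.refl ℝ, fun _ => rfl⟩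
  mul_mem' := by
    rintro φ ψ ⟨f, hf⟩ ⟨g, hg⟩
    exact ⟨g.trans f, fun x => by
      change φ (ψ x) = _
      rw [hg, hf]
      rfl⟩
  inv_mem' := by
    rintro φ ⟨f, hf⟩
    refine ⟨f.symm, fun x => ?_⟩
    change φ.symm x = _
    rw [φ.symm_apply_eq, hf, f.apply_symm_apply]

namespace AutCircle

open CirclePath

theorem exists_lift (ψ : AutCircle) : ∃ f : ℝ ≃o ℝ, (∀ x : ℝ, ψ.1 x = (f x : UnitAddCircle)) ∧
    ∀ x, f (x + 1) = f x + 1 := by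
  obtain ⟨f, hf⟩ := ψ.2
  refine ⟨f, hf, fun x => ?_⟩
  have h1 : ((x + 1 : ℝ) : UnitAddCircle) = x := by simp
  obtain ⟨n, hn⟩ := coe_eq_coe (a := f x) (b := f (x + 1)) (by rw [← hf, ← hf, h1])
  have hlt : f x < f (x + 1) := f.strictMono (by linarith)
  have hn1 : 1 ≤ n := by
    have : (0 : ℝ) < n := by linarith
    exact_mod_cast this
  rcases hn1.eq_or_lt with h | h
  · rw [hn, ← h]; simp
  · exfalso
    obtain ⟨c, hc⟩ := f.surjective (f x + 1)
    have hn2 : (2 : ℝ) ≤ n := by exact_mod_cast h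
    have h2 : x < c := f.lt_iff_lt.1 (by linarith)
    have h3 : c < x + 1 := f.lt_iff_lt.1 (by linarith)
    have : (x : UnitAddCircle) = c := ψ.1.injective (by
      rw [hf, hf, hc]; simp)
    obtain ⟨m, hm⟩ := coe_eq_coe this
    have h4 : (0 : ℝ) < m := by linarith
    have h5 : (m : ℝ) < 1 := by linarith
    have h6 : 0 < m := by exact_mod_cast h4
    have h7 : m < 1 := by exact_mod_cast h5
    omega

theorem disp_map (ψ : AutCircle) (f : ℝ ≃o ℝ) (hf : ∀ x : ℝ, ψ.1 x = (f x : UnitAddCircle))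
    {x y : UnitAddCircle} (p : Path.Homotopic.Quotient x y) (a : ℝ)
    (ha : (a : UnitAddCircle) = x) :
    disp (p.map (ψ.1 : C(UnitAddCircle, UnitAddCircle))) = f (a + disp p) - f a := by
  obtain ⟨γ, Γ, hp, h⟩ := exists_rep p a ha
  have : p.map (ψ.1 : C(UnitAddCircle, UnitAddCircle)) =
      Path.Homotopic.Quotient.mk (γ.map ψ.1.continuous) := by rw [← hp]; rfl
  rw [this]
  exact disp_mk _ (Γ.map f.continuous) fun t => by
    change ψ.1 (γ t) = ((f (Γ t) : ℝ) : UnitAddCircle)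
    rw [h t, hf]

/-- The action of `ψ ∈ Aut S¹` on the category `S¹`: it sends the class of a path `γ` to the class
of `ψ ∘ γ`. -/
noncomputable def functor (ψ : AutCircle) : OrientedCircle ⥤ OrientedCircle where
  obj x := ⟨ψ.1 x.pt⟩
  map {x y} f := ⟨f.1.map (ψ.1 : C(UnitAddCircle, UnitAddCircle)), by
    obtain ⟨g, hg⟩ := ψ.2
    obtain ⟨a, ha⟩ := exists_base x.pt
    rw [isOriented_iff, disp_map ψ g hg f.1 a ha, sub_nonneg]
    exact g.monotone (by linarith [OrientedCircle.disp_nonneg f])⟩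
  map_id x := rfl
  map_comp f g := Subtype.ext ((FundamentalGroupoid.map
    (ψ.1 : C(UnitAddCircle, UnitAddCircle))).map_comp (X := ⟨_⟩) (Y := ⟨_⟩) (Z := ⟨_⟩) f.1 g.1)

theorem functor_map_one (ψ : AutCircle) (x : OrientedCircle) :
    (functor ψ).map (ZPlusCategory.one x) = ZPlusCategory.one ((functor ψ).obj x) := by
  obtain ⟨g, hg, hg1⟩ := exists_lift ψ
  obtain ⟨a, ha⟩ := exists_base x.pt
  refine OrientedCircle.hom_ext ?_
  rw [OrientedCircle.disp_one]
  refine (disp_map ψ g hg (ZPlusCategory.one x : x ⟶ x).1 a ha).trans ?_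
  rw [OrientedCircle.disp_one, hg1]
  ring

theorem functor_mul_map (ψ ψ' : AutCircle) {x y : OrientedCircle} (f : x ⟶ y) :
    (functor (ψ' * ψ)).map f = (functor ψ').map ((functor ψ).map f) :=
  Subtype.ext (Path.Homotopic.Quotient.map_comp (p := f.1)
    (f := (ψ.1 : C(UnitAddCircle, UnitAddCircle))) (g := (ψ'.1 : C(UnitAddCircle, UnitAddCircle))))

theorem functor_one_map {x y : OrientedCircle} (f : x ⟶ y) :
    (functor 1).map f = f := by
  obtain ⟨a, ha⟩ := exists_base x.pt
  refine OrientedCircle.hom_ext ((disp_map 1 (OrderIso.refl ℝ) (fun _ => rfl) f.1 a ha).trans ?_)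
  change a + disp f.1 - a = disp f.1
  ring

end AutCircle

/-! ### The `ℤ₊`-categories `π₀(S¹ \ F)` -/

/-- The non-empty finite subsets of `S¹`, ordered by inclusion. -/
abbrev CircleFinset : Type := {F : Finset UnitAddCircle // F.Nonempty}

/-- The complement `S¹ \ F`, as a subspace of `S¹`. -/
abbrev CircleCompl (F : CircleFinset) : Type := {x : UnitAddCircle // x ∉ F.1}

/-- The set of connected components of `S¹ \ F`. -/
abbrev CirclePi0 (F : CircleFinset) : Type := _root_.ConnectedComponents (CircleCompl F)

namespace CirclePi0

open CirclePath

theorem mk_eq_of_arc {F : CircleFinset} {x y : CircleCompl F} {a b : ℝ} (hab : a ≤ b)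
    (ha : (a : UnitAddCircle) = x.1) (hb : (b : UnitAddCircle) = y.1)
    (h : ∀ t ∈ Set.Icc a b, (t : UnitAddCircle) ∉ F.1) : (x : CirclePi0 F) = y := by
  have hi : Topology.IsInducing (Subtype.val : CircleCompl F → UnitAddCircle) := ⟨rfl⟩
  have hs : _root_.IsPreconnected ((Subtype.val : CircleCompl F → UnitAddCircle) ⁻¹'
      (((↑) : ℝ → UnitAddCircle) '' Set.Icc a b)) := by
    rw [← hi.isPreconnected_image, Set.image_preimage_eq_of_subset]
    · exact isPreconnected_Icc.image _ (AddCircle.continuous_mk' 1).continuousOn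
    · rintro _ ⟨t, ht, rfl⟩
      exact ⟨⟨_, h t ht⟩, rfl⟩
  rw [ConnectedComponents.coe_eq_coe']
  exact hs.subset_connectedComponent (x := y) ⟨b, ⟨hab, le_rfl⟩, hb⟩ ⟨a, ⟨le_rfl, hab⟩, ha⟩

theorem arc_lt_one (F : CircleFinset) {a b : ℝ}
    (h : ∀ t ∈ Set.Icc a b, (t : UnitAddCircle) ∉ F.1) : b - a < 1 := by
  by_contra hc
  obtain ⟨f, hf⟩ := F.2
  have h1 : f ∈ ((↑) : ℝ → UnitAddCircle) '' Set.Icc a (a + 1) := by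
    rw [AddCircle.coe_image_Icc_eq]; trivial
  obtain ⟨t, ht, rfl⟩ := h1
  exact h t ⟨ht.1, by linarith [ht.2]⟩ hf

instance (F : CircleFinset) : LocallyPathConnectedSpace (CircleCompl F) :=
  have : LocallyPathConnectedSpace UnitAddCircle :=
    inferInstanceAs (LocallyPathConnectedSpace (Quotient _))
  IsOpen.locallyPathConnectedSpace (U := {x : UnitAddCircle | x ∉ F.1})
    F.1.finite_toSet.isClosed.isOpen_compl

/-- The class in `S¹` of a path in `S¹ \ F`. -/
def pathClass {F : CircleFinset} {x y : CircleCompl F} (γ : Path x y) :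
    Path.Homotopic.Quotient x.1 y.1 :=
  Path.Homotopic.Quotient.mk (γ.map continuous_subtype_val)

theorem pathClass_avoids {F : CircleFinset} {x y : CircleCompl F} (γ : Path x y) {a : ℝ}
    (ha : (a : UnitAddCircle) = x.1) :
    ∀ t ∈ Set.uIcc a (a + disp (pathClass γ)), (t : UnitAddCircle) ∉ F.1 := by
  obtain ⟨b, Γ, h⟩ := exists_lift (γ.map continuous_subtype_val) a ha
  have hb : a + disp (pathClass γ) = b := by
    rw [pathClass, disp_mk _ Γ h]; ring
  rw [hb]
  intro t ht
  have ho : (Set.range Γ).OrdConnected := (isPreconnected_range Γ.continuous).ordConnected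
  obtain ⟨s, rfl⟩ := ho.uIcc_subset ⟨0, Γ.source⟩ ⟨1, Γ.target⟩ ht
  rw [← h s]
  exact (γ s).2

theorem abs_disp_pathClass_lt {F : CircleFinset} {x y : CircleCompl F} (γ : Path x y) :
    |disp (pathClass γ)| < 1 := by
  obtain ⟨a, ha⟩ := exists_base x.1
  have h := arc_lt_one F (pathClass_avoids γ ha)
  rw [max_sub_min_eq_abs, add_sub_cancel_left] at h
  exact h

theorem pathClass_eq {F : CircleFinset} {x y : CircleCompl F} (γ γ' : Path x y) :
    pathClass γ = pathClass γ' := by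
  have h := abs_disp_pathClass_lt (γ.trans γ'.symm)
  have e : pathClass (γ.trans γ'.symm) = (pathClass γ).trans (pathClass γ').symm := by
    rw [pathClass, Path.map_trans]; rfl
  have hd : disp (pathClass (γ.trans γ'.symm)) = disp (pathClass γ) - disp (pathClass γ') := by
    rw [e, disp_trans, disp_symm]; ring
  have hc := CirclePath.coe_add_disp (pathClass (γ.trans γ'.symm))
  obtain ⟨n, hn⟩ := (AddCircle.coe_eq_zero_iff (p := (1 : ℝ))).1 (add_eq_left.1 hc)
  have hn' : disp (pathClass (γ.trans γ'.symm)) = n := by rw [← hn]; simp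
  rw [hn'] at h hd
  have : n = 0 := Int.abs_lt_one_iff.1 (by exact_mod_cast h)
  refine disp_injective ?_
  rw [this] at hd
  push_cast at hd
  linarith

/-- The chosen point of a connected component. -/
noncomputable def rep {F : CircleFinset} (c : CirclePi0 F) : CircleCompl F := Quot.out c

theorem mk_rep {F : CircleFinset} (c : CirclePi0 F) : (rep c : CirclePi0 F) = c := Quot.out_eq c

theorem joined_of_mk_eq {F : CircleFinset} {x y : CircleCompl F} (h : (x : CirclePi0 F) = y) :
    Joined x y := by
  have := ConnectedComponents.coe_eq_coe'.1 h.symm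
  rw [← pathComponent_eq_connectedComponent] at this
  exact this

/-- A path inside `S¹ \ F` from `x` to the chosen point of its component. -/
noncomputable def toRep {F : CircleFinset} (x : CircleCompl F) : Path x (rep (x : CirclePi0 F)) :=
  (joined_of_mk_eq (mk_rep (x : CirclePi0 F)).symm).somePath

/-- The class of a path from `x` to `y`, conjugated by paths inside `S¹ \ F` from `x` and `y` to
the chosen points of their components. -/
noncomputable def conj {F : CircleFinset} {x y : CircleCompl F}
    (p : Path.Homotopic.Quotient x.1 y.1) :
    Path.Homotopic.Quotient (rep (x : CirclePi0 F)).1 (rep (y : CirclePi0 F)).1 :=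
  ((pathClass (toRep x)).symm.trans p).trans (pathClass (toRep y))

theorem disp_conj {F : CircleFinset} {x y : CircleCompl F} (p : Path.Homotopic.Quotient x.1 y.1) :
    disp (conj p) = disp p - disp (pathClass (toRep x)) + disp (pathClass (toRep y)) := by
  rw [conj, disp_trans, disp_trans, disp_symm]
  ring

theorem isOriented_conj {F : CircleFinset} {x y : CircleCompl F}
    (p : Path.Homotopic.Quotient x.1 y.1) (hp : IsOriented p) : IsOriented (conj p) := by
  rw [isOriented_iff] at hp ⊢
  rw [disp_conj]
  obtain ⟨a, ha⟩ := exists_base x.1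
  have hb : ((a + disp p : ℝ) : UnitAddCircle) = y.1 := by
    rw [AddCircle.coe_add, ha, CirclePath.coe_add_disp]
  have h1 := pathClass_avoids (toRep x) ha
  have h2 := pathClass_avoids (toRep y) hb
  have h1e : ((a + disp (pathClass (toRep x)) : ℝ) : UnitAddCircle) = (rep (x : CirclePi0 F)).1 := by
    rw [AddCircle.coe_add, ha, CirclePath.coe_add_disp]
  have h2e : ((a + disp p + disp (pathClass (toRep y)) : ℝ) : UnitAddCircle) =
      (rep (y : CirclePi0 F)).1 := by
    rw [AddCircle.coe_add, hb, CirclePath.coe_add_disp]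
  set u := disp (pathClass (toRep x))
  set v := disp (pathClass (toRep y))
  by_contra hneg
  have hlt : a + disp p + v < a + u := by linarith
  have hav : ∀ t ∈ Set.Icc (a + disp p + v) (a + u), (t : UnitAddCircle) ∉ F.1 := by
    intro t ht
    rcases le_total a t with h | h
    · exact h1 t (Set.mem_uIcc.2 (Or.inl ⟨h, ht.2⟩))
    · exact h2 t (Set.mem_uIcc.2 (Or.inr ⟨ht.1, by linarith⟩))
  have hxy := mk_eq_of_arc hlt.le h2e h1e hav
  rw [mk_rep, mk_rep] at hxy
  rw [hxy] at h2e
  obtain ⟨n, hn⟩ := coe_eq_coe (h2e.trans h1e.symm)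
  have h3 := arc_lt_one F hav
  have h4 : (0 : ℝ) < n := by linarith
  have h5 : (n : ℝ) < 1 := by linarith
  have h6 : 0 < n := by exact_mod_cast h4
  have h7 : n < 1 := by exact_mod_cast h5
  omega

instance (F : CircleFinset) : Finite (CirclePi0 F) := by
  classical
  have hex : ∀ x : UnitAddCircle, ∃ a : ℝ, (a : UnitAddCircle) = x ∧ a ∈ Set.Ico (0 : ℝ) 1 :=
    fun x => by
      have h : x ∈ ((↑) : ℝ → UnitAddCircle) '' Set.Ico 0 (0 + 1) := by
        rw [AddCircle.coe_image_Ico_eq]; trivial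
      obtain ⟨a, ha, h⟩ := h
      exact ⟨a, h, by simpa using ha⟩
  choose l hl hl1 using hex
  have hll : ∀ t ∈ Set.Ico (0 : ℝ) 1, l t = t := fun t ht => by
    obtain ⟨n, hn⟩ := coe_eq_coe (hl (t : UnitAddCircle))
    have := hl1 (t : UnitAddCircle)
    simp only [Set.mem_Ico] at this ht
    have h1 : (n : ℝ) < 1 := by linarith
    have h2 : (-1 : ℝ) < n := by linarith
    have h1' : n < 1 := by exact_mod_cast h1
    have h2' : -1 < n := by exact_mod_cast h2
    have : n = 0 := by omega
    rw [this] at hn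
    simpa using hn.symm
  have key : ∀ x y : CircleCompl F, l x.1 ≤ l y.1 →
      (∀ f ∈ F.1, l f < l y.1 → l f < l x.1) → (x : CirclePi0 F) = y := fun x y hxy h =>
    mk_eq_of_arc hxy (hl _) (hl _) fun t ht hF => by
      have ht1 : t ∈ Set.Ico (0 : ℝ) 1 := ⟨(hl1 _).1.trans ht.1, ht.2.trans_lt (hl1 _).2⟩
      have e := hll t ht1
      rcases ht.2.eq_or_lt with h' | h'
      · apply y.2
        rw [← hl y.1, ← h']
        exact hF
      · exact absurd (h _ hF (by rw [e]; exact h')) (by rw [e]; exact not_lt.2 ht.1)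
  have hinj : Function.Injective (fun c : CirclePi0 F =>
      (⟨F.1.filter (fun f => l f < l (rep c).1), Finset.filter_subset _ _⟩ :
        {s : Finset UnitAddCircle // s ⊆ F.1})) := by
    intro a b hab
    have hab' : ∀ f ∈ F.1, (l f < l (rep a).1 ↔ l f < l (rep b).1) := by
      intro f hf
      have := congrArg (fun s => f ∈ s.1) hab
      simpa [hf] using this
    rw [← mk_rep a, ← mk_rep b]
    rcases le_total (l (rep a).1) (l (rep b).1) with h | h
    · exact key _ _ h fun f hf => (hab' f hf).2
    · exact (key _ _ h fun f hf => (hab' f hf).1).symm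
  have : Finite {s : Finset UnitAddCircle // s ⊆ F.1} :=
    Finite.of_equiv {s // s ∈ F.1.powerset} (Equiv.subtypeEquivRight fun s => Finset.mem_powerset)
  exact Finite.of_injective _ hinj

instance (F : CircleFinset) : Nonempty (CirclePi0 F) := by
  have : Infinite UnitAddCircle :=
    (AddCircle.equivIco (1 : ℝ) 0).infinite_iff.2 (Set.Ico_infinite (by norm_num)).to_subtype
  obtain ⟨x, hx⟩ := Infinite.exists_notMem_finset F.1
  exact ⟨((⟨x, hx⟩ : CircleCompl F) : CirclePi0 F)⟩

/-- `S¹ \ F` as a full subcategory of `S¹`. -/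
noncomputable abbrev punctured (F : CircleFinset) : ZPlusCat :=
  circleSub fun x : CircleCompl F => (⟨x.1⟩ : OrientedCircle)

/-- The `ℤ₊`-category `π₀(S¹ \ F)`. Its objects are the connected components of `S¹ \ F`. It is
characterized by a `ℤ₊`-functor from `S¹ \ F` whose restriction to any system of representatives
of the components is an isomorphism; so its morphisms are those between chosen representatives. -/
noncomputable abbrev cat (F : CircleFinset) : ZPlusCat :=
  circleSub fun c : CirclePi0 F => (⟨(rep c).1⟩ : OrientedCircle)

/-- The connected component of a point. -/
abbrev comp {F : CircleFinset} (x : CircleCompl F) : CirclePi0 F := (x : CirclePi0 F)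

/-- The functor `π_F : S¹ \ F → π₀(S¹ \ F)`. It sends a point to its component, and the class of a
path `γ` from `x` to `y` to that of `γ` conjugated by paths inside `S¹ \ F` from `x` and `y` to the
chosen points of their components. -/
noncomputable def proj (F : CircleFinset) : punctured F ⟶ cat F where
  functor :=
    { obj := fun x => comp (F := F) x
      map := fun {x y} f => InducedCategory.homMk
        ⟨conj (F := F) (x := x) (y := y) f.hom.1, isOriented_conj f.hom.1 f.hom.2⟩
      map_id := fun x => circleSub.hom_ext (by
        refine (disp_conj (F := F) (x := x) (y := x) (𝟙 x : x ⟶ x).hom.1).trans (Eq.trans ?_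
          (circleSub.disp_id (comp (F := F) x)).symm)
        have : disp (𝟙 x : x ⟶ x).hom.1 = 0 := circleSub.disp_id x
        rw [this]
        ring)
      map_comp := fun {x y z} f g => circleSub.hom_ext (by
        refine (disp_conj (F := F) (x := x) (y := z) _).trans (Eq.trans ?_
          (circleSub.disp_comp _ _).symm)
        have h : disp (f ≫ g).hom.1 = disp f.hom.1 + disp g.hom.1 := circleSub.disp_comp f g
        have hf := disp_conj (F := F) (x := x) (y := y) f.hom.1
        have hg := disp_conj (F := F) (x := y) (y := z) g.hom.1
        refine Eq.trans ?_ (congrArg₂ (· + ·) hf hg).symm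
        rw [h]
        ring) }
  map_one x := circleSub.hom_ext (by
    refine (disp_conj (F := F) (x := x) (y := x) (ZPlusCategory.one x : x ⟶ x).hom.1).trans (Eq.trans ?_
      (circleSub.disp_one (comp (F := F) x)).symm)
    have : disp (ZPlusCategory.one x : x ⟶ x).hom.1 = 1 := circleSub.disp_one x
    rw [this]
    ring)

/-- The inclusion of the system of chosen representatives. -/
noncomputable def incl (F : CircleFinset) : cat F ⟶ punctured F where
  functor :=
    { obj := fun c => rep (F := F) c
      map := fun f => InducedCategory.homMk f.hom
      map_id := fun _ => rfl
      map_comp := fun _ _ => rfl }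
  map_one _ := rfl

/-- The functor `S¹ \ G → S¹ \ F` induced by `ψ ∈ Aut S¹` with `ψ (S¹ \ G) ⊆ S¹ \ F`. -/
noncomputable def puncturedMap (ψ : AutCircle) {G F : CircleFinset}
    (h : ∀ x, x ∉ G.1 → ψ.1 x ∉ F.1) : punctured G ⟶ punctured F where
  functor :=
    { obj := fun x => (⟨ψ.1 x.1, h x.1 x.2⟩ : CircleCompl F)
      map := fun f => InducedCategory.homMk ((AutCircle.functor ψ).map f.hom)
      map_id := fun x => InducedCategory.hom_ext ((AutCircle.functor ψ).map_id ⟨x.1⟩)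
      map_comp := fun f g => InducedCategory.hom_ext ((AutCircle.functor ψ).map_comp f.hom g.hom) }
  map_one x := InducedCategory.hom_ext (AutCircle.functor_map_one ψ ⟨x.1⟩)

/-- The `ℤ₊`-functor `π₀(S¹ \ G) → π₀(S¹ \ F)` induced by `ψ ∈ Aut S¹` with
`ψ (S¹ \ G) ⊆ S¹ \ F`; it is characterized by `proj_comp_map`. -/
noncomputable def map (ψ : AutCircle) {G F : CircleFinset}
    (h : ∀ x, x ∉ G.1 → ψ.1 x ∉ F.1) : cat G ⟶ cat F :=
  incl G ≫ puncturedMap ψ h ≫ proj F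

theorem disp_proj {F : CircleFinset} {x y : (punctured F).carrier} (f : x ⟶ y) :
    circleSub.disp ((proj F).functor.map f) = circleSub.disp f - disp (pathClass (toRep (F := F) x))
      + disp (pathClass (toRep (F := F) y)) :=
  disp_conj (F := F) (x := x) (y := y) f.hom.1

theorem disp_toRep_rep {F : CircleFinset} (c : CirclePi0 F) :
    disp (pathClass (toRep (rep c))) = 0 := by
  rw [pathClass_eq (toRep (rep c)) ((Path.refl (rep c)).cast rfl (by rw [mk_rep]))]
  obtain ⟨a, ha⟩ := exists_base (rep c).1
  refine (disp_mk _ (Path.refl a) fun t => ?_).trans (sub_self a)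
  exact ha.symm

theorem disp_toRep {F : CircleFinset} {x y : CircleCompl F} (γ : Path x y) :
    disp (pathClass (toRep x)) = disp (pathClass γ) + disp (pathClass (toRep y)) := by
  have hxy : (x : CirclePi0 F) = y := by
    rw [ConnectedComponents.coe_eq_coe']
    exact pathComponent_subset_component y (⟨γ.symm⟩ : Joined y x)
  rw [pathClass_eq (toRep x) ((γ.trans (toRep y)).cast rfl (by rw [hxy])), ← disp_trans]
  obtain ⟨a, ha⟩ := exists_base x.1
  obtain ⟨b, Γ, h⟩ := exists_lift ((γ.trans (toRep y)).map continuous_subtype_val) a ha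
  have e : (pathClass γ).trans (pathClass (toRep y)) = pathClass (γ.trans (toRep y)) := by
    rw [pathClass, pathClass, pathClass, Path.map_trans]; rfl
  rw [e]
  exact (disp_mk _ Γ fun t => h t).trans (disp_mk _ Γ h).symm

theorem incl_comp_proj (F : CircleFinset) : incl F ≫ proj F = 𝟙 (cat F) :=
  circleSub.functor_ext (fun c => mk_rep (F := F) c) fun {c c'} f => by
    refine (disp_proj (F := F) (x := rep (F := F) c) (y := rep (F := F) c')
      ((incl F).functor.map f)).trans ?_
    rw [disp_toRep_rep, disp_toRep_rep]
    change circleSub.disp f - 0 + 0 = circleSub.disp f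
    ring

theorem disp_puncturedMap (ψ : AutCircle) {G F : CircleFinset}
    (h : ∀ x, x ∉ G.1 → ψ.1 x ∉ F.1) (f : ℝ ≃o ℝ) (hf : ∀ x : ℝ, ψ.1 x = (f x : UnitAddCircle))
    {x y : (punctured G).carrier} (g : x ⟶ y) (a : ℝ) (ha : (a : UnitAddCircle) = x.1) :
    circleSub.disp ((puncturedMap ψ h).functor.map g) = f (a + circleSub.disp g) - f a :=
  AutCircle.disp_map ψ f hf g.hom.1 a ha

/-- `map ψ` is compatible with `ψ : S¹ \ G → S¹ \ F`. -/
theorem proj_comp_map (ψ : AutCircle) {G F : CircleFinset} (h : ∀ x, x ∉ G.1 → ψ.1 x ∉ F.1) :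
    proj G ≫ map ψ h = puncturedMap ψ h ≫ proj F := by
  have hpath : ∀ x : CircleCompl G, ∃ γ : Path (⟨ψ.1 x.1, h x.1 x.2⟩ : CircleCompl F)
      ⟨ψ.1 (rep (comp x)).1, h _ (rep (comp x)).2⟩, pathClass γ =
        (pathClass (toRep x)).map (ψ.1 : C(UnitAddCircle, UnitAddCircle)) := fun x =>
    ⟨(toRep x).map (f := fun x : CircleCompl G => (⟨ψ.1 x.1, h x.1 x.2⟩ : CircleCompl F))
      ((ψ.1.continuous.comp continuous_subtype_val).subtype_mk _), rfl⟩
  obtain ⟨f, hf⟩ := ψ.2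
  refine circleSub.functor_ext (fun x => ?_) fun {x y} g => ?_
  · obtain ⟨γ, -⟩ := hpath x
    change comp (F := F) _ = comp (F := F) _
    rw [ConnectedComponents.coe_eq_coe']
    exact pathComponent_subset_component _ (⟨γ⟩ : Joined _ _)
  · obtain ⟨a, ha⟩ := exists_base x.1
    obtain ⟨γ, hγ⟩ := hpath x
    obtain ⟨γ', hγ'⟩ := hpath y
    have hb : ((a + circleSub.disp g : ℝ) : UnitAddCircle) = y.1 := by
      rw [AddCircle.coe_add, ha]
      exact circleSub.coe_add_disp g
    have hr : ((a + disp (pathClass (toRep (F := G) x)) : ℝ) : UnitAddCircle) =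
        (rep (comp (F := G) x)).1 := by
      rw [AddCircle.coe_add, ha, CirclePath.coe_add_disp]
    have e1 : circleSub.disp ((proj G ≫ map ψ h).functor.map g) = _ :=
      disp_proj (F := F) ((puncturedMap ψ h).functor.map
        ((incl G).functor.map ((proj G).functor.map g)))
    have e2 : circleSub.disp ((puncturedMap ψ h ≫ proj F).functor.map g) = _ :=
      disp_proj (F := F) ((puncturedMap ψ h).functor.map g)
    have e3 := disp_puncturedMap ψ h f hf ((incl G).functor.map ((proj G).functor.map g)) _ hr
    have e4 := disp_puncturedMap ψ h f hf g a ha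
    have e5 : circleSub.disp ((incl G).functor.map ((proj G).functor.map g)) = _ := disp_proj g
    have e6 := disp_toRep γ
    have e7 := disp_toRep γ'
    rw [hγ, AutCircle.disp_map ψ f hf _ a ha] at e6
    rw [hγ', AutCircle.disp_map ψ f hf _ _ hb] at e7
    rw [e5] at e3
    rw [e1, e2, e3, e4]
    have e8 : a + disp (pathClass (toRep (F := G) x)) + (circleSub.disp g -
        disp (pathClass (toRep (F := G) x)) + disp (pathClass (toRep (F := G) y))) =
        a + circleSub.disp g + disp (pathClass (toRep (F := G) y)) := by ring
    rw [e8]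
    change _ - disp (pathClass (toRep (F := F) ⟨ψ.1 (rep (comp (F := G) x)).1, _⟩)) +
      disp (pathClass (toRep (F := F) ⟨ψ.1 (rep (comp (F := G) y)).1, _⟩)) =
      _ - disp (pathClass (toRep (F := F) ⟨ψ.1 x.1, _⟩)) +
      disp (pathClass (toRep (F := F) ⟨ψ.1 y.1, _⟩))
    rw [e6, e7]
    ring

theorem map_one (F : CircleFinset) (h : ∀ x, x ∉ F.1 → (1 : AutCircle).1 x ∉ F.1) :
    map 1 h = 𝟙 (cat F) := by
  have : puncturedMap 1 h = 𝟙 (punctured F) :=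
    circleSub.functor_ext (fun _ => rfl) fun f =>
      congrArg (fun g => CirclePath.disp (Subtype.val g)) (AutCircle.functor_one_map f.hom)
  rw [map, this, Category.id_comp, incl_comp_proj]

theorem map_comp (ψ ψ' : AutCircle) {G F E : CircleFinset} (h : ∀ x, x ∉ G.1 → ψ.1 x ∉ F.1)
    (h' : ∀ x, x ∉ F.1 → ψ'.1 x ∉ E.1) (h'' : ∀ x, x ∉ G.1 → (ψ' * ψ).1 x ∉ E.1) :
    map ψ h ≫ map ψ' h' = map (ψ' * ψ) h'' := by
  have : puncturedMap ψ h ≫ puncturedMap ψ' h' = puncturedMap (ψ' * ψ) h'' :=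
    circleSub.functor_ext (fun _ => rfl) fun f =>
      (congrArg (fun g => CirclePath.disp (Subtype.val g))
        (AutCircle.functor_mul_map ψ ψ' f.hom)).symm
  rw [map, Category.assoc, Category.assoc, proj_comp_map, map, ← this, Category.assoc]

/-- `π₀(S¹ \ F)` as an object of `Λ_big`. -/
noncomputable def obj (F : CircleFinset) : BigCyclicCategory :=
  ⟨cat F, isCyc_circleSub _ fun c c' h => by
    have h1 : (rep c).1 = (rep c').1 := congrArg OrientedCircle.pt h
    rw [← mk_rep c, ← mk_rep c', Subtype.ext h1]⟩

/-- `map ψ` as a morphism of `Λ_big`. -/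
noncomputable def homMap (ψ : AutCircle) {G F : CircleFinset}
    (h : ∀ x, x ∉ G.1 → ψ.1 x ∉ F.1) : obj G ⟶ obj F :=
  isCyc.homMk (map ψ h)

end CirclePi0

/-- The system `F ↦ π₀(S¹ \ F)`, indexed by the non-empty finite subsets of `S¹`; for `F ⊆ G` the
transition functor is the canonical one `π₀(S¹ \ G) → π₀(S¹ \ F)`. -/
noncomputable def circleDiagram : CircleFinset ⥤ BigCyclicCategoryᵒᵖ where
  obj F := Opposite.op (CirclePi0.obj F)
  map {F G} i := (CirclePi0.homMap 1 (G := G) (F := F) fun _ hx hF => hx (leOfHom i hF)).op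
  map_id F := by
    refine congrArg Quiver.Hom.op (isCyc.hom_ext ?_)
    exact CirclePi0.map_one F _
  map_comp {F G H} i j := by
    rw [← op_comp]
    refine congrArg Quiver.Hom.op (isCyc.hom_ext ?_)
    exact (CirclePi0.map_comp 1 1 _ _ _).symm

/-- The category of cyclic sets. -/
abbrev CyclicSet : Type (u + 1) := CyclicCategoryᵒᵖ ⥤ Type u

namespace CyclicSet

/-- The extension of a cyclic set to `Λ_big`. -/
noncomputable def extend (X : CyclicSet.{u}) : BigCyclicCategoryᵒᵖ ⥤ Type u :=
  cyclicInclusion.asEquivalence.inverse.op ⋙ X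

/-- The geometric realization functor from cyclic sets to sets, `|X| = colim_F X(π₀(S¹ \ F))`. -/
noncomputable def setRealization : CyclicSet.{u} ⥤ Type u :=
  (Functor.whiskeringLeft _ _ (Type u)).obj
    (circleDiagram ⋙ cyclicInclusion.asEquivalence.inverse.op) ⋙ colim

/-- The canonical map `X(π₀(S¹ \ F)) → |X|`. -/
noncomputable def setRealizationι (X : CyclicSet.{u}) (F : CircleFinset) :
    X.extend.obj (Opposite.op (CirclePi0.obj F)) ⟶ setRealization.obj X :=
  colimit.ι (circleDiagram ⋙ X.extend) F

end CyclicSet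

/-! Both statements follow one pattern. The realization is a filtered colimit of evaluation
functors, so by Yoneda a natural endomorphism is determined by the images of the generic elements,
the classes of the identities of `D F`. Such an image is again the class of a morphism `h : D G ⟶ D
F`. The group acts by such morphisms, which gives the homomorphism `Action.toAut`.

To invert it, choose a test object `b` such that the realization of its presheaf is the space
itself. For simplicial sets `b` is the two-element order: a monotone map from `π₀(I \ F)` to it
amounts to the point where it jumps, so the realization of the 1-simplex is `I`. For cyclic sets `b`
is the one-point category: a functor from `π₀(S¹ \ F)` to it amounts to the point `z` that a path
must cross in order to have positive degree, so the realization is `S¹`. Hence every automorphism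
`α` induces a permutation `σ` of the space (`perm`). By naturality, if `α` sends the generic element
at `F` to the class of `h`, then `h` followed by the threshold map at `z ∈ F` jumps at `σ z`. So `h`
knows `σ` on `F`, and two facts remain.

The permutation respects the order (`perm_monotone`), respectively the cyclic order (`lt_of_jump`),
because `h` is a morphism of orders, respectively of `ℤ₊`-categories. A bijection respecting the
order is automatically a homeomorphism; on the circle it is first lifted to `ℝ`
(`exists_of_cyclic`).

If `σ = 1`, then `α = 1` (the two lemmas `eq_one_of_perm`): the jumps force `h` to be the canonical
map. In the interval the thresholds at points of `F` separate components. On the circle they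
determine the object map once `F` has two points (`obj_eq_of_jump`), and one threshold then
determines the morphisms (`eq_map_of_jump`). -/

/-! ### Realizations along a directed diagram, and their generic elements. -/

namespace DiagramRealization

open Opposite

variable {J : Type} [Preorder J] {B : Type 1} [Category.{0} B] {C : Type} [SmallCategory C]
  (D : J ⥤ Bᵒᵖ) (S : B ⥤ C)

/-- The functor `X ↦ colim_F X(S(D F))`. -/
noncomputable abbrev realization : (Cᵒᵖ ⥤ Type u) ⥤ Type u :=
  (Functor.whiskeringLeft _ _ (Type u)).obj (D ⋙ S.op) ⋙ colim

/-- The class in the realization of `X` of an element of `X(S(D F))`. -/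
noncomputable def ι (X : Cᵒᵖ ⥤ Type u) (F : J) (ξ : X.obj (op (S.obj (D.obj F).unop))) :
    (realization D S).obj X :=
  colimit.ι ((D ⋙ S.op) ⋙ X) F ξ

theorem map_ι {X Y : Cᵒᵖ ⥤ Type u} (f : X ⟶ Y) (F : J)
    (ξ : X.obj (op (S.obj (D.obj F).unop))) :
    (realization D S).map f (ι D S X F ξ) = ι D S Y F (f.app _ ξ) :=
  ConcreteCategory.congr_hom
    (colimit.ι_map (F := (D ⋙ S.op) ⋙ X) (G := (D ⋙ S.op) ⋙ Y) (Functor.whiskerLeft (D ⋙ S.op) f) F)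
    ξ

theorem ι_transition (X : Cᵒᵖ ⥤ Type u) {F G : J} (h : F ≤ G)
    (ξ : X.obj (op (S.obj (D.obj F).unop))) :
    ι D S X G (X.map (S.map (D.map (homOfLE h)).unop).op ξ) = ι D S X F ξ :=
  ConcreteCategory.congr_hom (colimit.w ((D ⋙ S.op) ⋙ X) (homOfLE h)) ξ

theorem exists_ι (X : Cᵒᵖ ⥤ Type u) (x : (realization D S).obj X) :
    ∃ F ξ, ι D S X F ξ = x :=
  Types.jointly_surjective' (F := (D ⋙ S.op) ⋙ X) x

/-- A compatible family of functions descends to the realization. -/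
theorem exists_desc (X : Cᵒᵖ ⥤ Type u) {T : Type u}
    (g : ∀ F, X.obj (op (S.obj (D.obj F).unop)) → T)
    (hg : ∀ {F G : J} (h : F ≤ G) ξ, g G (X.map (S.map (D.map (homOfLE h)).unop).op ξ) = g F ξ) :
    ∃ d : (realization D S).obj X → T, ∀ F ξ, d (ι D S X F ξ) = g F ξ := by
  let s : Cocone ((D ⋙ S.op) ⋙ X) :=
    { pt := T
      ι := { app := fun F => TypeCat.ofHom (g F)
             naturality := fun F G f => by
              ext ξ
              exact hg (leOfHom f) ξ } }
  exact ⟨fun x => colimit.desc _ s x, fun F ξ =>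
    ConcreteCategory.congr_hom (colimit.ι_desc s F) ξ⟩

/-- The presheaf represented by `S b`. -/
abbrev rep (b : B) : Cᵒᵖ ⥤ Type u := uliftYoneda.{u}.obj (S.obj b)

/-- A morphism as an element of the represented presheaf. -/
def repMk {b : B} {c : C} (f : c ⟶ S.obj b) : (rep.{u} S b).obj (op c) := ⟨f⟩

variable {S} in
/-- An element of the represented presheaf as a morphism. -/
def repHom {b : B} {c : C} (ξ : (rep.{u} S b).obj (op c)) : c ⟶ S.obj b := ξ.down

/-- The map of represented presheaves induced by `q`. -/
abbrev repMap {b b' : B} (q : b ⟶ b') : rep.{u} S b ⟶ rep S b' := uliftYoneda.map (S.map q)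

/-- The class of a morphism `D F ⟶ b` in the realization of the presheaf represented by `S b`. -/
noncomputable def el {b : B} (F : J) (h : (D.obj F).unop ⟶ b) :
    (realization D S).obj (rep.{u} S b) :=
  ι D S (rep S b) F (repMk S (S.map h))

theorem map_el {b b' : B} (F : J) (h : (D.obj F).unop ⟶ b) (q : b ⟶ b') :
    (realization D S).map (repMap.{u} S q) (el D S F h) = el D S F (h ≫ q) := by
  rw [el, map_ι, el, S.map_comp]
  rfl

theorem el_transition {b : B} {F G : J} (hFG : F ≤ G) (h : (D.obj F).unop ⟶ b) :
    el.{u} D S G ((D.map (homOfLE hFG)).unop ≫ h) = el D S F h := by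
  rw [el, el, ← ι_transition D S _ hFG, S.map_comp]
  rfl

theorem exists_el [S.Full] {b : B} (x : (realization D S).obj (rep.{u} S b)) :
    ∃ F h, el D S F h = x := by
  obtain ⟨F, ξ, rfl⟩ := exists_ι D S _ x
  obtain ⟨h, hh⟩ := S.map_surjective (repHom ξ)
  exact ⟨F, h, by rw [el, hh]; rfl⟩

theorem exists_el_ge [S.Full] [IsDirectedOrder J] {b : B} (F₀ : J)
    (x : (realization D S).obj (rep.{u} S b)) :
    ∃ F, F₀ ≤ F ∧ ∃ h, el D S F h = x := by
  obtain ⟨F, h, rfl⟩ := exists_el D S x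
  obtain ⟨G, h₀, h₁⟩ := exists_ge_ge F₀ F
  exact ⟨G, h₀, _, el_transition D S h₁ h⟩

/-- Yoneda: `ξ` is a map to `X` from the presheaf represented by `S(D F)`, and it carries the
generic element to the class of `ξ`. -/
theorem ι_eq_map_el (X : Cᵒᵖ ⥤ Type u) (F : J) (ξ : X.obj (op (S.obj (D.obj F).unop))) :
    ι D S X F ξ = (realization D S).map (uliftYonedaEquiv.{u}.symm ξ)
      (el D S F (𝟙 _)) := by
  rw [el, map_ι, S.map_id]
  exact congrArg _ (uliftYonedaEquiv.{u}.apply_symm_apply ξ).symm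

/-- A function on the realization of a represented presheaf given by a compatible family. -/
theorem exists_desc_el [S.Full] [S.Faithful] {b : B} {T : Type}
    (g : ∀ F, ((D.obj F).unop ⟶ b) → T)
    (hg : ∀ {F G : J} (h : F ≤ G) f, g G ((D.map (homOfLE h)).unop ≫ f) = g F f) :
    ∃ d : (realization D S).obj (rep.{u} S b) → T, ∀ F f, d (el D S F f) = g F f := by
  -- `ULift` only adjusts universes: the colimit is formed in `Type u`, whereas `T` lies in `Type`.
  obtain ⟨d, hd⟩ := exists_desc D S (rep.{u} S b) (T := ULift.{u} T)
    (fun F ξ => ⟨g F (S.preimage (repHom ξ))⟩) (by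
      intro F G h ξ
      rw [← hg h]
      congr 2
      apply S.map_injective
      rw [S.map_preimage, S.map_comp, S.map_preimage]
      rfl)
  exact ⟨fun x => (d x).down, fun F f =>
    (congrArg ULift.down (hd F _)).trans (congrArg (g F) (S.preimage_map f))⟩

variable {D S}

theorem app_map (α : realization.{u} D S ⟶ realization D S) {X Y : Cᵒᵖ ⥤ Type u} (f : X ⟶ Y)
    (x : (realization D S).obj X) :
    α.app Y ((realization D S).map f x) = (realization D S).map f (α.app X x) :=
  NatTrans.naturality_apply α f x

/-- Every element of every realization is the image of a generic element, and by the transition maps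
a cofinal family of indices suffices. The freedom to enlarge `F` is needed for the circle. -/
theorem aut_ext {α β : Aut (realization.{u} D S)}
    (h : ∀ F, ∃ G, F ≤ G ∧ α.hom.app _ (el D S G (𝟙 _)) = β.hom.app _ (el D S G (𝟙 _))) :
    α = β := by
  refine Iso.ext (NatTrans.ext (funext fun X => ConcreteCategory.hom_ext _ _ fun x => ?_))
  obtain ⟨F, ξ, rfl⟩ := exists_ι D S X x
  obtain ⟨G, hG, e⟩ := h F
  rw [← ι_transition D S X hG, ι_eq_map_el]
  exact (app_map α.hom _ _).trans ((congrArg _ e).trans (app_map β.hom _ _).symm)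

theorem aut_mul_app (α β : Aut (realization.{u} D S)) (X) (x : (realization D S).obj X) :
    (α * β).hom.app X x = α.hom.app X (β.hom.app X x) := rfl

theorem aut_inv_app (α : Aut (realization.{u} D S)) (X) (x : (realization D S).obj X) :
    (α⁻¹).hom.app X (α.hom.app X x) = x := by
  rw [← aut_mul_app, inv_mul_cancel]
  rfl

theorem aut_app_inv (α : Aut (realization.{u} D S)) (X) (x : (realization D S).obj X) :
    α.hom.app X ((α⁻¹).hom.app X x) = x := by
  rw [← aut_mul_app, mul_inv_cancel]
  rfl

/-! ### The permutation induced on a test presheaf. -/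

section Perm

variable {P : Type} {b : B} (E : (realization D S).obj (rep.{u} S b) ≃ P)

/-- The permutation of the realization of a represented presheaf given by an automorphism of the
realization functor. -/
noncomputable def perm : Aut (realization.{u} D S) →* Equiv.Perm P where
  toFun α :=
    { toFun := fun p => E (α.hom.app _ (E.symm p))
      invFun := fun p => E ((α⁻¹).hom.app _ (E.symm p))
      left_inv := fun p => by
        refine Eq.trans (congrArg (fun y => E ((α⁻¹).hom.app _ y)) (E.symm_apply_apply _)) ?_
        exact (congrArg E (aut_inv_app α _ _)).trans (E.apply_symm_apply p)
      right_inv := fun p => by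
        refine Eq.trans (congrArg (fun y => E (α.hom.app _ y)) (E.symm_apply_apply _)) ?_
        exact (congrArg E (aut_app_inv α _ _)).trans (E.apply_symm_apply p) }
  map_one' := Equiv.ext fun p => E.apply_symm_apply p
  map_mul' α β := Equiv.ext fun p => by
    exact congrArg (fun y => E (α.hom.app _ y)) (E.symm_apply_apply (β.hom.app _ (E.symm p))).symm

theorem perm_apply (α : Aut (realization.{u} D S)) (x : (realization D S).obj (rep.{u} S b)) :
    perm E α (E x) = E (α.hom.app _ x) :=
  congrArg (fun y => E (α.hom.app _ y)) (E.symm_apply_apply x)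

/-- If `α` sends the generic element at `F` to the class of `h`, it sends the class of `q` to the
class of `h ≫ q`. -/
theorem perm_el (α : Aut (realization.{u} D S)) {F G : J} {h : (D.obj G).unop ⟶ (D.obj F).unop}
    (e : α.hom.app _ (el D S F (𝟙 _)) = el D S G h) (q : (D.obj F).unop ⟶ b) :
    perm E α (E (el D S F q)) = E (el D S G (h ≫ q)) := by
  have h1 := app_map α.hom (repMap S q) (el D S F (𝟙 _))
  rw [map_el, Category.id_comp] at h1
  rw [perm_apply, ← map_el, ← e]
  exact congrArg E h1

end Perm

/-! ### Group actions on the diagram and the comparison homomorphism. -/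

variable (D)

/-- An action of a group on a diagram, up to cofinal reindexing: `rel φ F G` says that `φ` induces
a morphism `D G ⟶ D F`. -/
structure Action (A : Type) [Group A] where
  rel : A → J → J → Prop
  mor : ∀ {φ F G}, rel φ F G → ((D.obj G).unop ⟶ (D.obj F).unop)
  exists_rel : ∀ φ F, ∃ G, rel φ F G
  rel_one : ∀ {F G}, F ≤ G → rel 1 F G
  mor_one : ∀ {F G} (h : F ≤ G), mor (rel_one h) = (D.map (homOfLE h)).unop
  rel_mul : ∀ {φ ψ F G H}, rel φ F G → rel ψ G H → rel (ψ * φ) F H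
  mor_mul : ∀ {φ ψ F G H} (h : rel φ F G) (h' : rel ψ G H), mor h' ≫ mor h = mor (rel_mul h h')

namespace Action

variable {D} {A : Type} [Group A] (a : Action D A) (S)

theorem rel_mono {φ : A} {F F' G G' : J} (h : a.rel φ F G) (hF : F' ≤ F) (hG : G ≤ G') :
    a.rel φ F' G' := by
  simpa using a.rel_mul (a.rel_mul (a.rel_one hF) h) (a.rel_one hG)

theorem mor_congr {φ ψ : A} (e : φ = ψ) {F G : J} (h : a.rel φ F G) (h' : a.rel ψ F G) :
    a.mor h = a.mor h' := by
  subst e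
  rfl

theorem mor_left {φ : A} {F F' G : J} (h : a.rel φ F G) (hF : F' ≤ F) (h' : a.rel φ F' G) :
    a.mor h ≫ (D.map (homOfLE hF)).unop = a.mor h' := by
  rw [← a.mor_one hF, a.mor_mul]
  exact a.mor_congr (mul_one φ) _ _

theorem mor_right {φ : A} {F G G' : J} (h : a.rel φ F G) (hG : G ≤ G') (h' : a.rel φ F G') :
    (D.map (homOfLE hG)).unop ≫ a.mor h = a.mor h' := by
  rw [← a.mor_one hG, a.mor_mul]
  exact a.mor_congr (one_mul φ) _ _

/-- Independence of the target index, by comparison at a common upper bound. It makes the arbitrary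
choice of `G` in `exists_act` harmless. -/
theorem ι_mor_eq [IsDirectedOrder J] (X : Cᵒᵖ ⥤ Type u) {φ : A} {F G G' : J} (h : a.rel φ F G)
    (h' : a.rel φ F G') (ξ : X.obj (op (S.obj (D.obj F).unop))) :
    ι D S X G (X.map (S.map (a.mor h)).op ξ) = ι D S X G' (X.map (S.map (a.mor h')).op ξ) := by
  obtain ⟨H, hH, hH'⟩ := exists_ge_ge G G'
  have k := a.rel_mono h le_rfl hH
  rw [← ι_transition D S X hH, ← ι_transition D S X hH', ← Functor.map_comp_apply,
    ← Functor.map_comp_apply, ← op_comp, ← op_comp, ← S.map_comp, ← S.map_comp,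
    a.mor_right h hH k, a.mor_right h' hH' k]

theorem exists_act [IsDirectedOrder J] (φ : A) (X : Cᵒᵖ ⥤ Type u) :
    ∃ d : (realization D S).obj X → (realization D S).obj X,
      ∀ {F G} (h : a.rel φ F G) ξ, d (ι D S X F ξ) = ι D S X G (X.map (S.map (a.mor h)).op ξ) := by
  choose G hG using a.exists_rel φ
  obtain ⟨d, hd⟩ := exists_desc D S X
    (fun F ξ => ι D S X (G F) (X.map (S.map (a.mor (hG F))).op ξ)) (by
      intro F F' h ξ
      rw [← Functor.map_comp_apply, ← op_comp, ← S.map_comp,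
        a.mor_left (hG F') h (a.rel_mono (hG F') h le_rfl)]
      exact a.ι_mor_eq S X _ _ ξ)
  exact ⟨d, fun h ξ => (hd _ ξ).trans (a.ι_mor_eq S X _ _ ξ)⟩

/-- The action of a group element on the realization. -/
noncomputable def act [IsDirectedOrder J] (φ : A) (X : Cᵒᵖ ⥤ Type u)
    (x : (realization D S).obj X) : (realization D S).obj X :=
  (a.exists_act S φ X).choose x

variable [IsDirectedOrder J]

theorem act_ι (X : Cᵒᵖ ⥤ Type u) {φ : A} {F G : J} (h : a.rel φ F G)
    (ξ : X.obj (op (S.obj (D.obj F).unop))) :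
    a.act S φ X (ι D S X F ξ) = ι D S X G (X.map (S.map (a.mor h)).op ξ) :=
  (a.exists_act S φ X).choose_spec h ξ

theorem act_el {b : B} {φ : A} {F G : J} (h : a.rel φ F G) (f : (D.obj F).unop ⟶ b) :
    a.act S φ (rep.{u} S b) (el D S F f) = el D S G (a.mor h ≫ f) := by
  rw [el, a.act_ι S _ h, el, S.map_comp]
  rfl

theorem act_one (X : Cᵒᵖ ⥤ Type u) (x : (realization D S).obj X) : a.act S 1 X x = x := by
  obtain ⟨F, ξ, rfl⟩ := exists_ι D S X x
  rw [a.act_ι S X (a.rel_one (le_refl F)), a.mor_one, ι_transition]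
  exact le_rfl

theorem act_mul (φ ψ : A) (X : Cᵒᵖ ⥤ Type u) (x : (realization D S).obj X) :
    a.act S (φ * ψ) X x = a.act S φ X (a.act S ψ X x) := by
  obtain ⟨F, ξ, rfl⟩ := exists_ι D S X x
  obtain ⟨G, hG⟩ := a.exists_rel ψ F
  obtain ⟨H, hH⟩ := a.exists_rel φ G
  rw [a.act_ι S X hG, a.act_ι S X hH, a.act_ι S X (a.rel_mul hG hH), ← a.mor_mul hG hH,
    S.map_comp, op_comp, Functor.map_comp_apply]

theorem act_map (φ : A) {X Y : Cᵒᵖ ⥤ Type u} (f : X ⟶ Y) (x : (realization D S).obj X) :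
    a.act S φ Y ((realization D S).map f x) = (realization D S).map f (a.act S φ X x) := by
  obtain ⟨F, ξ, rfl⟩ := exists_ι D S X x
  obtain ⟨G, hG⟩ := a.exists_rel φ F
  rw [map_ι, a.act_ι S X hG, a.act_ι S Y hG, map_ι, NatTrans.naturality_apply]

/-- The homomorphism to the automorphism group of the realization functor. -/
noncomputable def toAut : A →* Aut (realization.{u} D S) :=
  MonoidHom.mk'
    (fun φ =>
      { hom :=
          { app := fun X => TypeCat.ofHom (a.act S φ X)
            naturality := fun X Y f => by
              ext x
              exact a.act_map S φ f x }
        inv :=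
          { app := fun X => TypeCat.ofHom (a.act S φ⁻¹ X)
            naturality := fun X Y f => by
              ext x
              exact a.act_map S φ⁻¹ f x }
        hom_inv_id := by
          ext X x
          change a.act S φ⁻¹ X (a.act S φ X x) = x
          rw [← a.act_mul, inv_mul_cancel, a.act_one]
        inv_hom_id := by
          ext X x
          change a.act S φ X (a.act S φ⁻¹ X x) = x
          rw [← a.act_mul, mul_inv_cancel, a.act_one] })
    (fun φ ψ => by
      refine Iso.ext (NatTrans.ext (funext fun X => ?_))
      ext x
      exact a.act_mul S φ ψ X x)

theorem toAut_app (φ : A) (X : Cᵒᵖ ⥤ Type u) (x : (realization D S).obj X) :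
    (a.toAut S φ).hom.app X x = a.act S φ X x := rfl

/-- The composite of `toAut` with `perm E` is `τ`. So injectivity of `τ` gives injectivity of
`toAut`, and an automorphism with the same permutation as some `φ` differs from `toAut φ` by an
element of the kernel of `perm E`. -/
theorem toAut_bijective {P : Type} {b : B} (E : (realization D S).obj (rep.{u} S b) ≃ P)
    (τ : A → Equiv.Perm P) (hτ : Function.Injective τ)
    (hact : ∀ φ x, E (a.act S φ _ x) = τ φ (E x)) (hsurj : ∀ α, ∃ φ, perm E α = τ φ)
    (hker : ∀ α, perm E α = 1 → α = 1) : Function.Bijective (a.toAut.{u} S) := by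
  have hp : ∀ φ, perm E (a.toAut S φ) = τ φ := fun φ => Equiv.ext fun p => by
    obtain ⟨x, rfl⟩ := E.surjective p
    rw [perm_apply, toAut_app, hact]
  refine ⟨fun φ ψ h => hτ (by rw [← hp, ← hp, h]), fun α => ?_⟩
  obtain ⟨φ, hφ⟩ := hsurj α
  refine ⟨φ, inv_mul_eq_one.1 (hker _ ?_)⟩
  rw [map_mul, map_inv, hp, hφ, inv_mul_cancel]

end Action

end DiagramRealization

/-! ### The interval: jump points and the realization of the 1-simplex. -/

namespace IntervalPi0

open DiagramRealization

/-- The value of a map `π₀(I \ F) → b` at the component of a point. -/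
noncomputable def eval {F : Finset unitInterval} {b : NonemptyFinLinOrd.{0}} (h : obj F ⟶ b)
    (x : IntervalCompl F) : b :=
  h (x : IntervalPi0 F)

theorem eval_comp {F : Finset unitInterval} {b b' : NonemptyFinLinOrd.{0}} (h : obj F ⟶ b)
    (q : b ⟶ b') (x : IntervalCompl F) : eval (h ≫ q) x = q (eval h x) := rfl

theorem eval_mono {F : Finset unitInterval} {b : NonemptyFinLinOrd.{0}} (h : obj F ⟶ b)
    {x y : IntervalCompl F} (hxy : x.1 ≤ y.1) : eval h x ≤ eval h y :=
  h.hom.hom.monotone ⟨x, y, rfl, rfl, hxy⟩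

theorem hom_ext_eval {F : Finset unitInterval} {b : NonemptyFinLinOrd.{0}} {h k : obj F ⟶ b}
    (e : ∀ x, eval h x = eval k x) : h = k := by
  ext a
  obtain ⟨x, rfl⟩ := ConnectedComponents.surjective_coe a
  exact e x

/-- The two-element ordered set. -/
abbrev two : NonemptyFinLinOrd.{0} := NonemptyFinLinOrd.of Bool

/-- `h` jumps from `false` to `true` at `z`. -/
def Jump {F : Finset unitInterval} (h : obj F ⟶ two) (z : unitInterval) : Prop :=
  ∀ x : IntervalCompl F, (x.1 < z → eval h x = false) ∧ (z < x.1 → eval h x = true)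

theorem exists_between_notMem (F : Finset unitInterval) {a b : unitInterval} (h : a < b) :
    ∃ x, a < x ∧ x < b ∧ x ∉ F := by
  obtain ⟨x, hx, hF⟩ := (Set.Ioo_infinite h).exists_notMem_finset F
  exact ⟨x, hx.1, hx.2, hF⟩

theorem Jump.unique {F : Finset unitInterval} {h : obj F ⟶ two} {z z' : unitInterval}
    (hz : Jump h z) (hz' : Jump h z') : z = z' := by
  have key : ∀ {z z'}, Jump h z → Jump h z' → ¬ z < z' := fun hz hz' hlt => by
    obtain ⟨x, h1, h2, hF⟩ := exists_between_notMem F hlt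
    have := (hz ⟨x, hF⟩).2 h1
    rw [(hz' ⟨x, hF⟩).1 h2] at this
    cases this
  exact le_antisymm (not_lt.1 (key hz' hz)) (not_lt.1 (key hz hz'))

theorem exists_jump {F : Finset unitInterval} (h : obj F ⟶ two) : ∃ z, Jump h z := by
  -- The supremum is taken in the complete lattice `I`: the constant map `true` jumps at `0`, the
  -- supremum of the empty set, and the constant map `false` jumps at `1`.
  refine ⟨sSup {x | ∃ hx : x ∉ F, eval h ⟨x, hx⟩ = false}, fun x => ⟨fun hx => ?_, fun hx => ?_⟩⟩
  · obtain ⟨y, ⟨hy, hyf⟩, hxy⟩ := lt_sSup_iff.1 hx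
    exact le_bot_iff.1 ((eval_mono h (y := ⟨y, hy⟩) hxy.le).trans_eq hyf)
  · by_contra hne
    exact hx.not_ge (le_sSup ⟨x.2, Bool.eq_false_iff.2 hne⟩)

/-- The point at which `h` jumps. -/
noncomputable def jumpPoint {F : Finset unitInterval} (h : obj F ⟶ two) : unitInterval :=
  (exists_jump h).choose

theorem jump_jumpPoint {F : Finset unitInterval} (h : obj F ⟶ two) : Jump h (jumpPoint h) :=
  (exists_jump h).choose_spec

theorem jumpPoint_eq_iff {F : Finset unitInterval} {h : obj F ⟶ two} {z : unitInterval} :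
    jumpPoint h = z ↔ Jump h z :=
  ⟨fun e => e ▸ jump_jumpPoint h, (jump_jumpPoint h).unique⟩

/-- Once `z` belongs to `F`, no point of the complement is left undecided, so the jump point
determines the map. This is why `F` is enlarged by `z` below. -/
theorem Jump.eval_eq {F : Finset unitInterval} {h : obj F ⟶ two} {z : unitInterval}
    (hz : Jump h z) (hF : z ∈ F) (x : IntervalCompl F) : eval h x = decide (z < x.1) := by
  rcases lt_trichotomy x.1 z with hx | hx | hx
  · rw [(hz x).1 hx, decide_eq_false hx.not_gt]
  · exact absurd (hx ▸ hF) x.2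
  · rw [(hz x).2 hx, decide_eq_true hx]

theorem Jump.comp_map {F G : Finset unitInterval} {h : obj F ⟶ two} {z : unitInterval}
    (hz : Jump h z) (φ : AutI) (hφ : ∀ x, x ∉ G → (φ⁻¹).1 x ∉ F) :
    Jump (map φ⁻¹ hφ ≫ h) (φ.1 z) := by
  have e : ∀ w, (φ⁻¹).1 (φ.1 w) = w := fun w => φ.1.symm_apply_apply w
  refine fun x => ⟨fun hx => (hz _).1 ?_, fun hx => (hz _).2 ?_⟩
  · have := (φ⁻¹).2 hx
    rwa [e] at this
  · have := (φ⁻¹).2 hx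
    rwa [e] at this

/-- The map `π₀(I \ F) → {false, true}` with jump at `z ∈ F`. -/
noncomputable def threshold {F : Finset unitInterval} {z : unitInterval} (hz : z ∈ F) :
    obj F ⟶ two :=
  NonemptyFinLinOrd.ofHom
    { toFun := fun c : IntervalPi0 F => decide (z < (Quot.out c : IntervalCompl F).1)
      monotone' := by
        rintro a b ⟨x, y, rfl, rfl, hxy⟩
        have hx := lt_iff_of_mk_eq (Quot.out_eq (x : IntervalPi0 F)) hz
        have hy := lt_iff_of_mk_eq (Quot.out_eq (y : IntervalPi0 F)) hz
        refine Bool.le_iff_imp.2 fun h => decide_eq_true (hy.2 ?_)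
        exact (hx.1 (of_decide_eq_true h)).trans_le hxy }

theorem eval_threshold {F : Finset unitInterval} {z : unitInterval} (hz : z ∈ F)
    (x : IntervalCompl F) : eval (threshold hz) x = decide (z < x.1) :=
  Bool.decide_congr (lt_iff_of_mk_eq (Quot.out_eq (x : IntervalPi0 F)) hz)

theorem eval_comp_threshold {F G : Finset unitInterval} (h : obj G ⟶ obj F) {z : unitInterval}
    (hz : z ∈ F) {x : IntervalCompl G} {y : IntervalCompl F} (hy : (y : IntervalPi0 F) = eval h x) :
    eval (h ≫ threshold hz) x = decide (z < y.1) := by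
  rw [eval_comp, ← hy]
  exact eval_threshold hz y

theorem jump_threshold {F : Finset unitInterval} {z : unitInterval} (hz : z ∈ F) :
    Jump (threshold hz) z := fun x =>
  ⟨fun h => by rw [eval_threshold, decide_eq_false h.not_gt],
    fun h => by rw [eval_threshold, decide_eq_true h]⟩

/-- The action of `Aut I` on the system `F ↦ π₀(I \ F)`. -/
noncomputable def action : Action intervalDiagram AutI where
  -- Equivalently `φ(F) ⊆ G`. Allowing an inclusion instead of an equality makes the transition maps
  -- the case `φ = 1`.
  rel φ F G := ∀ x, x ∉ G → (φ⁻¹).1 x ∉ F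
  mor {φ _ _} h := map φ⁻¹ h
  exists_rel φ F := by
    classical
    refine ⟨F.image φ.1, fun x hx hF => hx (Finset.mem_image.2 ⟨_, hF, φ.1.apply_symm_apply x⟩)⟩
  rel_one h _ hx hF := hx (h hF)
  mor_one _ := rfl
  rel_mul {φ ψ F G H} h h' x hx := by
    rw [mul_inv_rev]
    exact h _ (h' x hx)
  mor_mul {φ ψ F G H} h h' := by
    have : ∀ χ : AutI, χ = φ⁻¹ * ψ⁻¹ → ∀ hχ : ∀ x, x ∉ H → χ.1 x ∉ F,
        map ψ⁻¹ h' ≫ map φ⁻¹ h = map χ hχ := by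
      rintro _ rfl hχ
      exact map_comp _ _ _ _ _
    exact this _ (mul_inv_rev ψ φ) _

/-- The equivalence of the category of non-empty finite linearly ordered sets with its skeleton. -/
noncomputable abbrev skel : NonemptyFinLinOrd.{0} ⥤ SimplexCategory :=
  SimplexCategory.skeletalEquivalence.inverse

theorem jump_transition {F G : Finset unitInterval} (h : F ≤ G) (f : obj F ⟶ two)
    {z : unitInterval} (hz : Jump f z) : Jump ((intervalDiagram.map (homOfLE h)).unop ≫ f) z :=
  fun x => hz ⟨x.1, fun hF => x.2 (h hF)⟩

theorem el_eq_of_jump {F G : Finset unitInterval} {f : obj F ⟶ two} {g : obj G ⟶ two}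
    {z : unitInterval} (hf : Jump f z) (hg : Jump g z) :
    el.{u} intervalDiagram skel F f = el intervalDiagram skel G g := by
  classical
  have hF : F ≤ F ∪ G ∪ {z} := Finset.subset_union_left.trans Finset.subset_union_left
  have hG : G ≤ F ∪ G ∪ {z} := Finset.subset_union_right.trans Finset.subset_union_left
  have hz : z ∈ F ∪ G ∪ {z} := by simp
  refine (el_transition intervalDiagram skel hF f).symm.trans
    (Eq.trans ?_ (el_transition intervalDiagram skel hG g))
  refine congrArg _ (hom_ext_eval fun x => ?_)
  exact ((jump_transition hF f hf).eval_eq hz x).trans ((jump_transition hG g hg).eval_eq hz x).symm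

/-- The realization of the 1-simplex is `I`: two classes with the same jump point become equal after
that point is added to the finite set, and thresholds realize every point. -/
theorem exists_equiv : ∃ E : (realization intervalDiagram skel).obj (rep.{u} skel two) ≃ unitInterval,
    ∀ (F : Finset unitInterval) (f : obj F ⟶ two) (z : unitInterval),
      E (el intervalDiagram skel F f) = z ↔ Jump f z := by
  obtain ⟨d, hd⟩ := exists_desc_el.{u} intervalDiagram skel (b := two)
    (fun F f => jumpPoint (F := F) f) (fun h f =>
      jumpPoint_eq_iff.2 (jump_transition h f (jump_jumpPoint f)))
  refine ⟨Equiv.ofBijective d ⟨fun x y e => ?_, fun z => ?_⟩, fun F f z => ?_⟩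
  · obtain ⟨F, f, rfl⟩ := exists_el _ _ x
    obtain ⟨G, g, rfl⟩ := exists_el _ _ y
    rw [hd, hd] at e
    exact el_eq_of_jump (jumpPoint_eq_iff.1 e) (jump_jumpPoint g)
  · exact ⟨el intervalDiagram skel {z} (threshold (Finset.mem_singleton_self z)),
      (hd _ _).trans (jumpPoint_eq_iff.2 (jump_threshold _))⟩
  · exact (Eq.congr_left (hd F f)).trans jumpPoint_eq_iff

section

variable {E : (realization intervalDiagram skel).obj (rep.{u} skel two) ≃ unitInterval}

/-- Under `E` the threshold at `z` is the point `z`. Naturality of `α` turns it into `h` followed by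
that threshold, so the values of the permutation on `F` can be read off from `h`. -/
theorem jump_comp_threshold
    (hE : ∀ (F : Finset unitInterval) (f : obj F ⟶ two) (z : unitInterval),
      E (el intervalDiagram skel F f) = z ↔ Jump f z)
    {α : Aut (realization.{u} intervalDiagram skel)}
    {F G : Finset unitInterval} {h : obj G ⟶ obj F}
    (e : α.hom.app _ (el intervalDiagram skel F (𝟙 _)) = el intervalDiagram skel G h)
    {z : unitInterval} (hz : z ∈ F) : Jump (h ≫ threshold hz) (perm E α z) := by
  refine (hE G _ _).1 ((perm_el E α e (threshold hz)).symm.trans ?_)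
  exact congrArg (perm E α) ((hE F _ z).2 (jump_threshold hz))

/-- If the images of `s ≤ t` were in the wrong order, `h` would send a point lying strictly between
them to a component that is before `s` and after `t`. -/
theorem perm_monotone
    (hE : ∀ (F : Finset unitInterval) (f : obj F ⟶ two) (z : unitInterval),
      E (el intervalDiagram skel F f) = z ↔ Jump f z)
    (α : Aut (realization.{u} intervalDiagram skel)) : Monotone (perm E α) := by
  classical
  intro s t hst
  obtain ⟨G, h, e⟩ := exists_el _ _
    (α.hom.app _ (el intervalDiagram skel ({s, t} : Finset unitInterval) (𝟙 _)))
  have hs := jump_comp_threshold hE e.symm (z := s) (by simp)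
  have ht := jump_comp_threshold hE e.symm (z := t) (by simp)
  by_contra hlt
  obtain ⟨x, h1, h2, hG⟩ := exists_between_notMem G (not_le.1 hlt)
  have hxs := (hs ⟨x, hG⟩).1 h2
  have hxt := (ht ⟨x, hG⟩).2 h1
  -- `y` represents the component `h x`; the two thresholds compare it with `s` and `t`.
  obtain ⟨y, hy⟩ := ConnectedComponents.surjective_coe (eval h ⟨x, hG⟩)
  have hys := (eval_comp_threshold h _ hy).symm.trans hxs
  have hyt := (eval_comp_threshold h _ hy).symm.trans hxt
  exact of_decide_eq_false hys (hst.trans_lt (of_decide_eq_true hyt))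

/-- The components of `I \ F` are separated by the thresholds at points of `F`. With trivial
permutation, and `G ⊇ F` so that the jumps lie in `G`, these thresholds take the same values on `h
x` and on the component of `x`. Hence `h` is the canonical map. -/
theorem eq_one_of_perm
    (hE : ∀ (F : Finset unitInterval) (f : obj F ⟶ two) (z : unitInterval),
      E (el intervalDiagram skel F f) = z ↔ Jump f z)
    {α : Aut (realization.{u} intervalDiagram skel)} (hα : perm E α = 1) :
    α = 1 := by
  refine aut_ext fun F => ⟨F, le_rfl, ?_⟩
  obtain ⟨G, hG, h, e⟩ := exists_el_ge _ _ F
    (α.hom.app _ (el intervalDiagram skel F (𝟙 _)))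
  refine e.symm.trans (Eq.trans ?_ (el_transition intervalDiagram skel hG (𝟙 _)))
  rw [Category.comp_id]
  refine congrArg _ (hom_ext_eval fun x => ?_)
  obtain ⟨y, hy⟩ := ConnectedComponents.surjective_coe (eval h x)
  refine hy.symm.trans ?_
  have key : ∀ f ∈ F, (f < y.1 ↔ f < x.1) := fun f hf => by
    have hj := (jump_comp_threshold hE e.symm hf).eval_eq
      (by rw [hα]; exact hG hf) x
    rw [hα] at hj
    exact decide_eq_decide.1 ((eval_comp_threshold h hf hy).symm.trans hj)
  have hx : x.1 ∉ F := fun hF => x.2 (hG hF)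
  change (y : IntervalPi0 F) = ((⟨x.1, hx⟩ : IntervalCompl F) : IntervalPi0 F)
  rcases le_total y.1 x.1 with hle | hle
  · exact mk_eq_of_forall (y := ⟨x.1, hx⟩) hle fun f hf => (key f hf).2
  · exact (mk_eq_of_forall (x := ⟨x.1, hx⟩) hle fun f hf => (key f hf).1).symm

end

/-- A monotone permutation of `I` as an element of `Aut I`. -/
theorem exists_autI (σ : unitInterval ≃ unitInterval) (hσ : Monotone σ) :
    ∃ φ : AutI, ∀ x, φ.1 x = σ x := by
  have hs := hσ.strictMono_of_injective σ.injective
  exact ⟨⟨(hs.orderIsoOfSurjective σ σ.surjective).toHomeomorph, hs⟩, fun _ => rfl⟩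

theorem toAut_bijective : Function.Bijective (action.toAut.{u} skel) := by
  obtain ⟨E, hE⟩ := exists_equiv.{u}
  refine action.toAut_bijective skel E (fun φ => φ.1.toEquiv) (fun φ ψ h => ?_) (fun φ x => ?_)
    (fun α => ?_) fun α => eq_one_of_perm hE
  · exact Subtype.ext (Homeomorph.ext fun x => Equiv.congr_fun h x)
  · obtain ⟨F, f, rfl⟩ := exists_el _ _ x
    obtain ⟨G, hG⟩ := action.exists_rel φ F
    rw [action.act_el skel hG]
    exact (hE _ _ _).2 (((hE _ _ _).1 rfl).comp_map φ hG)
  · obtain ⟨φ, hφ⟩ := exists_autI (perm E α) (perm_monotone hE α)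
    exact ⟨φ, Equiv.ext fun x => (hφ x).symm⟩

end IntervalPi0

/-- The topology of `I` is the order topology, so increasing bijections are homeomorphisms. -/
theorem exists_autI_mulEquiv : ∃ r : AutI ≃* (unitInterval ≃o unitInterval),
    ∀ (φ : AutI) (x : unitInterval), r φ x = φ.1 x :=
  ⟨{ toFun := fun φ => φ.2.orderIsoOfSurjective φ.1 φ.1.surjective
     invFun := fun σ => ⟨σ.toHomeomorph, σ.strictMono⟩
     left_inv := fun _ => Subtype.ext (Homeomorph.ext fun _ => rfl)
     right_inv := fun _ => OrderIso.ext rfl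
     map_mul' := fun _ _ => OrderIso.ext rfl }, fun _ _ => rfl⟩

theorem exists_autI_mulEquiv_aut : ∃ e : AutI ≃* Aut SSet.setRealization.{u},
    ∀ (φ : AutI) (X : SSet.{u}) (F G : Finset unitInterval) (h : ∀ x, x ∉ G → (φ⁻¹).1 x ∉ F)
      (ξ : X.extend.obj (Opposite.op (IntervalPi0.obj F))),
      (e φ).hom.app X (SSet.setRealizationι X F ξ) =
        SSet.setRealizationι X G (X.extend.map (IntervalPi0.map φ⁻¹ h).op ξ) :=
  ⟨MulEquiv.ofBijective (IntervalPi0.action.toAut IntervalPi0.skel) IntervalPi0.toAut_bijective,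
    fun _ X _ _ h ξ => IntervalPi0.action.act_ι IntervalPi0.skel X h ξ⟩

/-! ### Displacements and `ℤ₊`-functors between full subcategories of the circle. -/

namespace circleSub

open CirclePath

variable {ι κ μ : Type} {p : ι → OrientedCircle} {q : κ → OrientedCircle} {r : μ → OrientedCircle}

theorem disp_map_congr {H K : circleSub p ⟶ circleSub q} (e : H = K) {i j : (circleSub p).carrier}
    (f : i ⟶ j) : disp (H.functor.map f) = disp (K.functor.map f) := by
  subst e
  rfl

/-- The endpoints determine the displacement modulo `1`. Equalities of objects are hypotheses so
that the result applies to images under functors whose values on objects are only propositionally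
equal. -/
theorem exists_int_of_eq {i j i' j' : (circleSub p).carrier} (hi : i = i') (hj : j = j')
    (f : i ⟶ j) (g : i' ⟶ j') : ∃ n : ℤ, disp f = disp g + n := by
  subst hi hj
  have h := (coe_add_disp f).trans (coe_add_disp g).symm
  obtain ⟨n, hn⟩ := coe_eq_coe (add_left_cancel h).symm
  exact ⟨n, hn⟩

/-- A morphism is determined by its displacement, so `f` is `g` preceded by `n` full turns, and `H`
preserves full turns. -/
theorem disp_map_add_nat (H : circleSub p ⟶ circleSub q) (n : ℕ) :
    ∀ {i j i' j' : (circleSub p).carrier} (_ : i = i') (_ : j = j') (f : i ⟶ j) (g : i' ⟶ j'),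
      disp f = disp g + n → disp (H.functor.map f) = disp (H.functor.map g) + n := by
  induction n with
  | zero =>
    rintro i j _ _ rfl rfl f g h
    rw [hom_ext (f := f) (g := g) (by simpa using h)]
    simp
  | succ n ih =>
    rintro i j _ _ rfl rfl f g h
    have h1 : disp (ZPlusCategory.one i ≫ g) = disp g + 1 := by
      rw [disp_comp, disp_one]
      ring
    have h2 : disp (H.functor.map (ZPlusCategory.one i ≫ g)) = disp (H.functor.map g) + 1 := by
      rw [H.functor.map_comp, disp_comp, H.map_one, disp_one]
      ring
    rw [ih rfl rfl f (ZPlusCategory.one i ≫ g) (by rw [h, h1]; push_cast; ring), h2]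
    push_cast
    ring

theorem exists_short {i j : (circleSub p).carrier} (f : i ⟶ j) :
    ∃ (g : i ⟶ j) (n : ℕ), disp g < 1 ∧ disp f = disp g + n := by
  obtain ⟨n, hn⟩ := Int.eq_ofNat_of_zero_le (Int.floor_nonneg.2 (disp_nonneg f))
  have hn' : ((⌊disp f⌋ : ℤ) : ℝ) = n := by rw [hn]; rfl
  obtain ⟨g, hg⟩ := exists_hom (p := p) (i := i) (j := j) (d := Int.fract (disp f))
    (Int.fract_nonneg _) (by
      rw [← coe_add_disp f]
      congr 1
      conv_rhs => rw [← Int.fract_add_floor (disp f)]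
      exact (coe_add_int _ _).symm)
  exact ⟨g, n, hg ▸ Int.fract_lt_one _, by rw [hg, ← hn', Int.fract_add_floor]⟩

theorem functor_ext_short {H K : circleSub p ⟶ circleSub q}
    (hobj : ∀ i, H.functor.obj i = K.functor.obj i)
    (hmap : ∀ {i j : (circleSub p).carrier} (f : i ⟶ j), disp f < 1 →
      disp (H.functor.map f) = disp (K.functor.map f)) : H = K :=
  functor_ext hobj fun f => by
    obtain ⟨g, n, hg, h⟩ := exists_short f
    rw [disp_map_add_nat H n rfl rfl f g h, disp_map_add_nat K n rfl rfl f g h, hmap g hg]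

/-- Morphisms with the same endpoints differ by full turns, which `R` preserves; so `R` is faithful,
whatever it does to objects. -/
theorem functor_ext_comp {H K : circleSub p ⟶ circleSub q} (R : circleSub q ⟶ circleSub r)
    (hobj : ∀ i, H.functor.obj i = K.functor.obj i) (hR : H ≫ R = K ≫ R) : H = K :=
  functor_ext hobj fun {i j} f => by
    have e : disp (R.functor.map (H.functor.map f)) = disp (R.functor.map (K.functor.map f)) :=
      disp_map_congr hR f
    obtain ⟨m, hm⟩ := exists_int_of_eq (hobj i) (hobj j) (H.functor.map f) (K.functor.map f)
    obtain ⟨n, rfl | rfl⟩ := m.eq_nat_or_neg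
    · have h := disp_map_add_nat R n (hobj i) (hobj j) _ _ (by simpa using hm)
      rw [hm]
      push_cast
      linarith
    · have h := disp_map_add_nat R n (hobj i).symm (hobj j).symm (K.functor.map f)
        (H.functor.map f) (by rw [hm]; push_cast; ring)
      rw [hm]
      push_cast
      linarith

theorem disp_map_eq_of_lift (H : circleSub p ⟶ circleSub q) {i j i' j' : (circleSub p).carrier}
    (hi : i = i') (hj : j = j') {f : i ⟶ j} {g : i' ⟶ j'} (h : disp f = disp g) :
    disp (H.functor.map f) = disp (H.functor.map g) := by
  simpa using disp_map_add_nat H 0 hi hj f g (by simpa using h)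

theorem disp_map_of_disp_eq_one (H : circleSub p ⟶ circleSub q) {i : (circleSub p).carrier}
    {f : i ⟶ i} (h : disp f = 1) : disp (H.functor.map f) = 1 := by
  rw [hom_ext (h.trans (disp_one i).symm), H.map_one, disp_one]

/-- A morphism of displacement at most `1` has a complement to a full turn. -/
theorem exists_complement {i j : (circleSub p).carrier} {f : i ⟶ j} (h : disp f ≤ 1) :
    ∃ g : j ⟶ i, disp g = 1 - disp f := by
  refine exists_hom (by linarith) ?_
  rw [← coe_add_disp f, add_assoc, ← AddCircle.coe_add]
  have : ((disp f + (1 - disp f) : ℝ) : UnitAddCircle) = 0 := by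
    rw [add_sub_cancel]
    simp
  rw [this, add_zero]

/-- The composite of `f` and `g` is a full turn, hence so is its image. Thus positive degree of one
arc excludes positive degree of the complementary arc in the one-point category. -/
theorem disp_map_complement (H : circleSub p ⟶ circleSub q) {i j : (circleSub p).carrier}
    {f : i ⟶ j} {g : j ⟶ i} (h : disp g = 1 - disp f) :
    disp (H.functor.map f) + disp (H.functor.map g) = 1 := by
  rw [← disp_comp, ← H.functor.map_comp]
  exact disp_map_of_disp_eq_one H (by rw [disp_comp, h]; ring)

/-- The full subcategory of `S¹` on one point. -/
noncomputable abbrev point : ZPlusCat := circleSub fun _ : Unit => (⟨0⟩ : OrientedCircle)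

theorem exists_disp_eq_nat {i j : point.carrier} (f : i ⟶ j) : ∃ n : ℕ, disp f = n := by
  obtain ⟨n, hn⟩ := exists_int_of_eq rfl (Subsingleton.elim (α := Unit) j i) f (𝟙 i)
  rw [disp_id, zero_add] at hn
  have h := disp_nonneg f
  rw [hn] at h
  obtain ⟨m, rfl⟩ := Int.eq_ofNat_of_zero_le (Int.cast_nonneg_iff.1 h)
  exact ⟨m, by simpa using hn⟩

theorem disp_eq_zero_of_not_one_le {i j : point.carrier} {f : i ⟶ j} (h : ¬ 1 ≤ disp f) :
    disp f = 0 := by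
  obtain ⟨n, hn⟩ := exists_disp_eq_nat f
  rw [hn] at h ⊢
  have : ¬ 1 ≤ n := fun h' => h (by exact_mod_cast h')
  simpa using this

/-- The functor to the one-point category defined by lifts of the points to `ℝ`. -/
theorem exists_functor_point (a : ι → ℝ) (ha : ∀ i, (a i : UnitAddCircle) = (p i).pt)
    (h1 : ∀ i j, a j - a i < 1) :
    ∃ R : circleSub p ⟶ point, ∀ {i j : (circleSub p).carrier} (f : i ⟶ j),
      disp (R.functor.map f) = disp f - (a j - a i) := by
  have key : ∀ {i j : (circleSub p).carrier} (f : i ⟶ j),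
      ∃ g : (show point.carrier from ()) ⟶ (show point.carrier from ()),
        disp g = disp f - (a j - a i) := by
    intro i j f
    have hc := coe_add_disp f
    rw [← ha i, ← ha j, ← AddCircle.coe_add] at hc
    obtain ⟨n, hn⟩ := coe_eq_coe hc
    -- An integer exceeding `-1`, because the lifts differ by less than `1`; so it is a legitimate
    -- displacement.
    have hn' : disp f - (a j - a i) = ((-n : ℤ) : ℝ) := by push_cast; linarith
    rw [hn']
    refine exists_hom ?_ ?_
    · have h2 := h1 i j
      have h3 := disp_nonneg f
      have h4 : (-1 : ℝ) < ((-n : ℤ) : ℝ) := by linarith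
      have h5 : -1 < -n := by exact_mod_cast h4
      exact_mod_cast (show 0 ≤ -n by omega)
    · simp
  refine ⟨⟨{ obj := fun _ => ()
             map := fun f => (key f).choose
             map_id := fun i => hom_ext ?_
             map_comp := fun f g => hom_ext ?_ }, fun i => hom_ext ?_⟩, fun f => ?_⟩
  · rw [(key _).choose_spec, disp_id, disp_id]
    ring
  · refine (key (f ≫ g)).choose_spec.trans (Eq.trans ?_ (disp_comp _ _).symm)
    rw [(key f).choose_spec, (key g).choose_spec, disp_comp]
    ring
  · change disp (key _).choose = _
    rw [(key _).choose_spec, disp_one, disp_one]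
    ring
  · exact (key f).choose_spec

end circleSub

/-! ### Jump points on the circle. -/

namespace CirclePi0

open CirclePath

theorem exists_lift_Ico (z : UnitAddCircle) (c : ℝ) :
    ∃ t : ℝ, (t : UnitAddCircle) = z ∧ c ≤ t ∧ t < c + 1 := by
  have h : z ∈ ((↑) : ℝ → UnitAddCircle) '' Set.Ico c (c + 1) := by
    rw [AddCircle.coe_image_Ico_eq]
    trivial
  obtain ⟨t, ht, h⟩ := h
  exact ⟨t, h, ht.1, ht.2⟩

theorem eq_of_mem_Ico {c s t : ℝ} (e : (s : UnitAddCircle) = t) (hs : c ≤ s) (hs' : s < c + 1)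
    (ht : c ≤ t) (ht' : t < c + 1) : s = t := by
  obtain ⟨n, hn⟩ := coe_eq_coe e
  have h1 : (n : ℝ) < 1 := by linarith
  have h2 : (-1 : ℝ) < n := by linarith
  have h1' : n < 1 := by exact_mod_cast h1
  have h2' : -1 < n := by exact_mod_cast h2
  have : n = 0 := by omega
  rw [this] at hn
  simpa using hn.symm

theorem exists_between_notMem (G : CircleFinset) {a b : ℝ} (h : a < b) :
    ∃ t : ℝ, a < t ∧ t < b ∧ (t : UnitAddCircle) ∉ G.1 := by
  -- The interval is cut to length at most `1` so that it embeds in the circle and its image is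
  -- infinite.
  have hab : a < min b (a + 1) := lt_min h (by linarith)
  have hinj : Set.InjOn ((↑) : ℝ → UnitAddCircle) (Set.Ioo a (min b (a + 1))) := by
    intro x hx y hy e
    exact eq_of_mem_Ico e hx.1.le (hx.2.trans_le (min_le_right _ _)) hy.1.le
      (hy.2.trans_le (min_le_right _ _))
  obtain ⟨_, ⟨t, ht, rfl⟩, hG⟩ := ((Set.Ioo_infinite hab).image hinj).exists_notMem_finset G.1
  exact ⟨t, ht.1, ht.2.trans_le (min_le_left _ _), hG⟩

/-- The object of `S¹ \ G` given by a real number. -/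
abbrev ofReal {G : CircleFinset} {a : ℝ} (ha : (a : UnitAddCircle) ∉ G.1) :
    (punctured G).carrier := (⟨a, ha⟩ : CircleCompl G)

/-- The morphism of `S¹ \ G` given by a segment in `ℝ`. -/
theorem exists_seg {G : CircleFinset} {a b : ℝ} (ha : (a : UnitAddCircle) ∉ G.1)
    (hb : (b : UnitAddCircle) ∉ G.1) (hab : a ≤ b) :
    ∃ f : (ofReal ha) ⟶
      (ofReal hb), circleSub.disp f = b - a := by
  refine circleSub.exists_hom (sub_nonneg.2 hab) ?_
  change (a : UnitAddCircle) + ((b - a : ℝ) : UnitAddCircle) = b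
  rw [← AddCircle.coe_add, add_sub_cancel]

/-- `H` jumps at `z`: every path passing through `z` has an image of positive degree. -/
def Jump {G : CircleFinset} (H : punctured G ⟶ circleSub.point) (z : UnitAddCircle) : Prop :=
  ∀ {x y : (punctured G).carrier} (f : x ⟶ y) (a t : ℝ), (a : UnitAddCircle) = x.1 →
    (t : UnitAddCircle) = z → a < t → t < a + circleSub.disp f →
    1 ≤ circleSub.disp (H.functor.map f)

/-- If `z ≠ z'`, cut the circle into two complementary arcs, one through `z` and one through `z'`.
Both would have degree at least `1`, but the degrees add up to `1`. -/
theorem Jump.unique {G : CircleFinset} {H : punctured G ⟶ circleSub.point} {z z' : UnitAddCircle}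
    (hz : Jump H z) (hz' : Jump H z') : z = z' := by
  by_contra hne
  obtain ⟨t, rfl⟩ := exists_base z
  obtain ⟨t', rfl, h1, h2⟩ := exists_lift_Ico z' t
  have h1 : t < t' := lt_of_le_of_ne h1 fun e => hne (e ▸ rfl)
  obtain ⟨a, ha1, ha2, ha⟩ := exists_between_notMem G (show t' - 1 < t by linarith)
  obtain ⟨b, hb1, hb2, hb⟩ := exists_between_notMem G h1
  obtain ⟨f, hf⟩ := exists_seg ha hb (by linarith)
  obtain ⟨g, hg⟩ := circleSub.exists_complement (f := f) (by linarith)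
  have e := circleSub.disp_map_complement H hg
  have e1 := hz f a t rfl rfl ha2 (by linarith)
  have e2 := hz' g b t' rfl rfl hb2 (by linarith)
  linarith

/-- Start at `a ∉ G` and go round until the degree stops being `0`; the jump is at the supremum
`sSup S`. A path of degree `0` through it would either prolong the segment of degree `0` beyond the
supremum or make the full turn at `a` have degree `0`. -/
theorem exists_jump {G : CircleFinset} (H : punctured G ⟶ circleSub.point) : ∃ z, Jump H z := by
  obtain ⟨a, -, -, ha⟩ := exists_between_notMem G (zero_lt_one (α := ℝ))
  let S : Set ℝ := {t | t ≤ a + 1 ∧ ∃ (ht : (t : UnitAddCircle) ∉ G.1)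
    (f : (ofReal ha) ⟶
      (ofReal ht)),
    circleSub.disp f = t - a ∧ circleSub.disp (H.functor.map f) = 0}
  have haS : a ∈ S := by
    refine ⟨by linarith, ha, 𝟙 _, by rw [circleSub.disp_id, sub_self], ?_⟩
    rw [H.functor.map_id, circleSub.disp_id]
  have hbdd : BddAbove S := ⟨a + 1, fun t ht => ht.1⟩
  refine ⟨((sSup S : ℝ) : UnitAddCircle), fun {x y} f c t hc ht hct htc => ?_⟩
  by_contra hlt
  have hf0 := circleSub.disp_eq_zero_of_not_one_le hlt
  obtain ⟨n, hn⟩ := coe_eq_coe ht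
  -- Translate the lift of `f` by an integer, so that it passes through `sSup S` itself.
  obtain ⟨A, hA⟩ : ∃ A, A = c + n := ⟨_, rfl⟩
  obtain ⟨b, hb⟩ : ∃ b, b = A + circleSub.disp f := ⟨_, rfl⟩
  have hAx : (A : UnitAddCircle) = x.1 := by rw [hA, coe_add_int, hc]
  have hby : (b : UnitAddCircle) = y.1 := by
    rw [hb, AddCircle.coe_add, hAx]
    exact circleSub.coe_add_disp f
  have hA1 : A < sSup S := by linarith
  have hb1 : sSup S < b := by linarith
  have hAG : (A : UnitAddCircle) ∉ G.1 := by rw [hAx]; exact x.2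
  have hbG : (b : UnitAddCircle) ∉ G.1 := by rw [hby]; exact y.2
  have hxa : x = (⟨A, hAG⟩ : CircleCompl G) := Subtype.ext hAx.symm
  have hyb' : y = (⟨b, hbG⟩ : CircleCompl G) := Subtype.ext hby.symm
  have haS' : a ≤ sSup S := le_csSup hbdd haS
  have hSa : sSup S ≤ a + 1 := csSup_le ⟨a, haS⟩ fun t ht => ht.1
  -- Degrees are nonnegative and additive, so every piece of `f` has degree `0`.
  have zero_of_sub : ∀ {s s' : ℝ} (hs : (s : UnitAddCircle) ∉ G.1)
      (hs' : (s' : UnitAddCircle) ∉ G.1) (_ : A ≤ s) (_ : s ≤ s') (_ : s' ≤ b)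
      (g : (ofReal hs) ⟶
        (ofReal hs'))
      (_ : circleSub.disp g = s' - s), circleSub.disp (H.functor.map g) = 0 := by
    intro s s' hs hs' h1 h2 h3 g hg
    obtain ⟨g1, hg1⟩ := exists_seg hAG hs h1
    obtain ⟨g2, hg2⟩ := exists_seg hs' hbG h3
    have e := circleSub.disp_map_eq_of_lift H hxa hyb' (f := f) (g := g1 ≫ g ≫ g2) (by
      rw [circleSub.disp_comp, circleSub.disp_comp, hg1, hg, hg2]
      linarith)
    rw [hf0, H.functor.map_comp, circleSub.disp_comp, H.functor.map_comp,
      circleSub.disp_comp] at e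
    have i1 := circleSub.disp_nonneg (H.functor.map g1)
    have i2 := circleSub.disp_nonneg (H.functor.map g)
    have i3 := circleSub.disp_nonneg (H.functor.map g2)
    linarith
  have zero_start : ∃ (s : ℝ) (hs : s ∈ S), A ≤ s := by
    obtain ⟨s, hs, h⟩ := exists_lt_of_lt_csSup ⟨a, haS⟩ hA1
    exact ⟨s, hs, h.le⟩
  obtain ⟨s, hs, hAs⟩ := zero_start
  obtain ⟨hs1, hsG, f1, hf1, hf1'⟩ := id hs
  have hsS : s ≤ sSup S := le_csSup hbdd hs
  rcases le_or_gt b (a + 1) with hba | hba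
  · obtain ⟨f2, hf2⟩ := exists_seg hsG hbG (by linarith)
    have hmem : b ∈ S := by
      refine ⟨hba, hbG, f1 ≫ f2, by rw [circleSub.disp_comp]; linarith, ?_⟩
      rw [H.functor.map_comp, circleSub.disp_comp, hf1',
        zero_of_sub hsG hbG hAs (by linarith) le_rfl f2 hf2, add_zero]
    exact hb1.not_ge (le_csSup hbdd hmem)
  -- Here `f` runs past `a + 1`, so the whole turn from `a` to `a + 1` would have degree `0`.
  · have ha1 : ((a + 1 : ℝ) : UnitAddCircle) = a := by simp
    have ha1G : ((a + 1 : ℝ) : UnitAddCircle) ∉ G.1 := by rw [ha1]; exact ha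
    obtain ⟨f2, hf2⟩ := exists_seg hsG ha1G hs1
    have e0 : circleSub.disp (H.functor.map (f1 ≫ f2)) = 0 := by
      rw [H.functor.map_comp, circleSub.disp_comp, hf1',
        zero_of_sub hsG ha1G hAs hs1 hba.le f2 hf2, add_zero]
    have e1 := circleSub.disp_map_eq_of_lift H rfl (Subtype.ext ha1) (f := f1 ≫ f2)
      (g := ZPlusCategory.one _) (by rw [circleSub.disp_comp, circleSub.disp_one]; linarith)
    rw [e0, H.map_one, circleSub.disp_one] at e1
    exact zero_ne_one e1

/-- Converse of the defining property of a jump. Since `z ∈ G`, neither endpoint is `z`; if `f`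
stopped before the first lift of `z` after `a`, the complementary arc would cross `z` and use up the
whole degree. -/
theorem Jump.exists_of_one_le {G : CircleFinset} {H : punctured G ⟶ circleSub.point}
    {z : UnitAddCircle} (hz : Jump H z) (hG : z ∈ G.1) {x y : (punctured G).carrier} (f : x ⟶ y)
    {a : ℝ} (ha : (a : UnitAddCircle) = x.1) (h1 : 1 ≤ circleSub.disp (H.functor.map f)) :
    ∃ t : ℝ, (t : UnitAddCircle) = z ∧ a < t ∧ t < a + circleSub.disp f := by
  obtain ⟨t, rfl, h2, h3⟩ := exists_lift_Ico z a
  have hy : ((a + circleSub.disp f : ℝ) : UnitAddCircle) = y.1 := by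
    rw [AddCircle.coe_add, ha]
    exact circleSub.coe_add_disp f
  have h2 : a < t := lt_of_le_of_ne h2 fun e => x.2 (by rw [← ha, e]; exact hG)
  refine ⟨t, rfl, h2, ?_⟩
  by_contra hle
  have h4 : a + circleSub.disp f < t := lt_of_le_of_ne (not_lt.1 hle) fun e =>
    y.2 (by rw [← hy, e]; exact hG)
  obtain ⟨g, hg⟩ := circleSub.exists_complement (f := f) (by linarith)
  have e := circleSub.disp_map_complement H hg
  have e2 := hz g _ t hy rfl h4 (by linarith)
  linarith

/-- A morphism shorter than a full turn has image of degree `0` or `1`, and crossing `z` decides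
which. -/
theorem Jump.functor_eq {G : CircleFinset} {H K : punctured G ⟶ circleSub.point}
    {z : UnitAddCircle} (hH : Jump H z) (hK : Jump K z) (hG : z ∈ G.1) : H = K := by
  have one_iff : ∀ {H K : punctured G ⟶ circleSub.point}, Jump H z → Jump K z →
      ∀ {x y : (punctured G).carrier} (f : x ⟶ y), 1 ≤ circleSub.disp (H.functor.map f) →
        1 ≤ circleSub.disp (K.functor.map f) := by
    intro H K hH hK x y f h
    obtain ⟨a, ha⟩ := exists_base x.1
    obtain ⟨t, ht, h1, h2⟩ := hH.exists_of_one_le hG f ha h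
    exact hK f a t ha ht h1 h2
  refine circleSub.functor_ext_short (fun _ => rfl) fun {x y} f hf => ?_
  have le_one : ∀ H : punctured G ⟶ circleSub.point, circleSub.disp (H.functor.map f) ≤ 1 := by
    intro H
    obtain ⟨g, hg⟩ := circleSub.exists_complement hf.le
    have := circleSub.disp_map_complement H hg
    linarith [circleSub.disp_nonneg (H.functor.map g)]
  by_cases h : 1 ≤ circleSub.disp (H.functor.map f)
  · rw [le_antisymm (le_one H) h, le_antisymm (le_one K) (one_iff hH hK f h)]
  · rw [circleSub.disp_eq_zero_of_not_one_le h,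
      circleSub.disp_eq_zero_of_not_one_le fun h' => h (one_iff hK hH f h')]

/-- `incl` is a section of `proj`. -/
theorem proj_cancel {G : CircleFinset} {ι : Type} {p : ι → OrientedCircle}
    {h k : cat G ⟶ circleSub p} (e : proj G ≫ h = proj G ≫ k) : h = k := by
  rw [← Category.id_comp h, ← Category.id_comp k, ← incl_comp_proj, Category.assoc, e,
    Category.assoc]

theorem Jump.puncturedMap_comp {F G : CircleFinset} {H : punctured F ⟶ circleSub.point}
    {z w : UnitAddCircle} (hz : Jump H z) (ψ : AutCircle) (hψ : ∀ x, x ∉ G.1 → ψ.1 x ∉ F.1)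
    (hw : ψ.1 w = z) : Jump (puncturedMap ψ hψ ≫ H) w := by
  obtain ⟨g, hg⟩ := ψ.2
  intro x y f a t ha ht h1 h2
  refine hz ((puncturedMap ψ hψ).functor.map f) (g a) (g t) ?_ ?_ (g.strictMono h1) ?_
  · rw [← hg, ha]
    rfl
  · rw [← hg, ht, hw]
  · rw [disp_puncturedMap ψ hψ g hg f a ha, add_sub_cancel]
    exact g.strictMono h2

/-- The path from `x` to the representative of its component avoids `F`, so its lift cannot pass
`t`. -/
theorem lt_lift_rep_iff {F : CircleFinset} {x : CircleCompl F} {a t : ℝ}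
    (ha : (a : UnitAddCircle) = x.1) (ht : (t : UnitAddCircle) ∈ F.1) :
    a + disp (pathClass (toRep x)) < t ↔ a < t := by
  have h := pathClass_avoids (toRep x) ha t
  rw [Set.mem_uIcc] at h
  have h' : ¬ _ := fun hh => h hh ht
  constructor
  · intro h1
    by_contra h2
    exact h' (Or.inr ⟨h1.le, not_lt.1 h2⟩)
  · intro h1
    by_contra h2
    exact h' (Or.inl ⟨h1.le, not_lt.1 h2⟩)

theorem lift_rep_lt_iff {F : CircleFinset} {x : CircleCompl F} {a t : ℝ}
    (ha : (a : UnitAddCircle) = x.1) (ht : (t : UnitAddCircle) ∈ F.1) :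
    t < a + disp (pathClass (toRep x)) ↔ t < a := by
  have h := pathClass_avoids (toRep x) ha t
  rw [Set.mem_uIcc] at h
  have h' : ¬ _ := fun hh => h hh ht
  constructor
  · intro h1
    by_contra h2
    exact h' (Or.inl ⟨not_lt.1 h2, h1.le⟩)
  · intro h1
    by_contra h2
    exact h' (Or.inr ⟨not_lt.1 h2, h1.le⟩)

theorem Jump.proj_incl {F : CircleFinset} {H : punctured F ⟶ circleSub.point} {z : UnitAddCircle}
    (hz : Jump H z) (hF : z ∈ F.1) : Jump (proj F ≫ incl F ≫ H) z := by
  intro x y f a t ha ht h1 h2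
  have htF : (t : UnitAddCircle) ∈ F.1 := by rw [ht]; exact hF
  have hb : ((a + circleSub.disp f : ℝ) : UnitAddCircle) = y.1 := by
    rw [AddCircle.coe_add, ha]
    exact circleSub.coe_add_disp f
  have e : circleSub.disp ((incl F).functor.map ((proj F).functor.map f)) = _ := disp_proj f
  refine hz ((incl F).functor.map ((proj F).functor.map f))
    (a + disp (pathClass (toRep (F := F) x))) t ?_ ht ((lt_lift_rep_iff ha htF).2 h1) ?_
  · rw [AddCircle.coe_add, ha]
    exact CirclePath.coe_add_disp _
  · rw [e]
    have := (lift_rep_lt_iff hb htF).2 h2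
    linarith

/-- Cut the circle at `z` and lift all points to `[c, c + 1)`. The resulting functor to the
one-point category counts how often a path passes the cut. -/
theorem exists_threshold {F : CircleFinset} {z : UnitAddCircle} (hz : z ∈ F.1) :
    ∃ T : cat F ⟶ circleSub.point, Jump (proj F ≫ T) z := by
  obtain ⟨c, rfl⟩ := exists_base z
  choose a ha h1 h2 using fun x : UnitAddCircle => exists_lift_Ico x c
  obtain ⟨R, hR⟩ := circleSub.exists_functor_point
    (p := fun x : CircleCompl F => (⟨x.1⟩ : OrientedCircle)) (fun x => a x.1) (fun x => ha x.1)
    (fun x y => by linarith [h1 x.1, h2 y.1])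
  refine ⟨incl F ≫ R, Jump.proj_incl (fun {x y} f s t hs ht hst hts => ?_) hz⟩
  have hb : ((s + circleSub.disp f : ℝ) : UnitAddCircle) = y.1 := by
    rw [AddCircle.coe_add, hs]
    exact circleSub.coe_add_disp f
  -- The path starts in sheet `n`, ends in sheet `m` and passes `c + k`, so `n < k ≤ m`; its degree
  -- is `m - n`.
  obtain ⟨n, hn⟩ := coe_eq_coe ((ha x.1).trans hs.symm)
  obtain ⟨m, hm⟩ := coe_eq_coe ((ha y.1).trans hb.symm)
  obtain ⟨k, hk⟩ := coe_eq_coe ht.symm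
  have e1 : n < k := by
    have := h1 x.1
    have : (n : ℝ) < k := by linarith
    exact_mod_cast this
  have e2 : k < m + 1 := by
    have := h2 y.1
    have : (k : ℝ) < m + 1 := by linarith
    exact_mod_cast this
  have e3 : (n : ℝ) + 1 ≤ m := by exact_mod_cast (show n + 1 ≤ m by omega)
  have e4 : circleSub.disp (R.functor.map f) = circleSub.disp f - (a y.1 - a x.1) := hR f
  rw [e4]
  linarith

/-- The functor `π₀(S¹ \ F) → pt` with jump at `z ∈ F`. -/
noncomputable def threshold {F : CircleFinset} {z : UnitAddCircle} (hz : z ∈ F.1) :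
    cat F ⟶ circleSub.point := (exists_threshold hz).choose

theorem jump_threshold {F : CircleFinset} {z : UnitAddCircle} (hz : z ∈ F.1) :
    Jump (proj F ≫ threshold hz) z := (exists_threshold hz).choose_spec

theorem one_le_threshold_iff {F : CircleFinset} {z : UnitAddCircle} (hz : z ∈ F.1)
    {c c' : (cat F).carrier} (g : c ⟶ c') {q : ℝ}
    (hq : (q : UnitAddCircle) = (CirclePi0.rep (F := F) c).1) :
    1 ≤ circleSub.disp ((threshold hz).functor.map g) ↔
      ∃ t : ℝ, (t : UnitAddCircle) = z ∧ q < t ∧ t < q + circleSub.disp g := by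
  have e : circleSub.disp ((proj F ≫ threshold hz).functor.map ((incl F).functor.map g)) =
      circleSub.disp ((threshold hz).functor.map g) :=
    circleSub.disp_map_congr (H := incl F ≫ proj F ≫ threshold hz) (K := threshold hz)
      (by rw [← Category.assoc, incl_comp_proj, Category.id_comp]) g
  rw [← e]
  constructor
  · exact fun h => Jump.exists_of_one_le (jump_threshold hz) hz ((incl F).functor.map g) hq h
  · rintro ⟨t, ht, h1, h2⟩
    exact jump_threshold hz ((incl F).functor.map g) q t hq ht h1 h2

/-- Both sides say that `f` has positive degree after `h` and the threshold at `z`. This turns the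
jump hypotheses into statements about which points of `F` the image of a path crosses. -/
theorem crossing_iff {F G : CircleFinset} {h : cat G ⟶ cat F} {z w : UnitAddCircle} (hz : z ∈ F.1)
    (hw : w ∈ G.1) (hj : Jump (proj G ≫ h ≫ threshold hz) w) {x y : (punctured G).carrier}
    (f : x ⟶ y) {a q : ℝ} (ha : (a : UnitAddCircle) = x.1)
    (hq : (q : UnitAddCircle) = (CirclePi0.rep (F := F) ((proj G ≫ h).functor.obj x)).1) :
    (∃ t : ℝ, (t : UnitAddCircle) = w ∧ a < t ∧ t < a + circleSub.disp f) ↔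
      ∃ t : ℝ, (t : UnitAddCircle) = z ∧ q < t ∧
        t < q + circleSub.disp ((proj G ≫ h).functor.map f) := by
  rw [← one_le_threshold_iff hz _ hq]
  constructor
  · rintro ⟨t, ht, h1, h2⟩
    exact hj f a t ha ht h1 h2
  · exact fun h => hj.exists_of_one_le hw f ha h

end CirclePi0

/-! ### Permutations of the circle that preserve the cyclic order. -/

namespace AutCircle

open CirclePath

theorem continuous_of_lift {σ : UnitAddCircle → UnitAddCircle} {f : ℝ → ℝ} (hf : Continuous f)
    (h : ∀ x : ℝ, σ x = (f x : UnitAddCircle)) : Continuous σ := by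
  have hq : Topology.IsQuotientMap ((↑) : ℝ → UnitAddCircle) := QuotientAddGroup.isQuotientMap_mk _
  rw [hq.continuous_iff, show σ ∘ ((↑) : ℝ → UnitAddCircle) = fun x => (f x : UnitAddCircle) from
    funext h]
  exact (AddCircle.continuous_mk' 1).comp hf

/-- A permutation of the circle which preserves the cyclic order of triples containing `0` is an
element of `Aut S¹`. -/
theorem exists_of_cyclic (σ : Equiv.Perm UnitAddCircle) (c : ℝ) (hc : (c : UnitAddCircle) = σ 0)
    (hσ : ∀ s t u v : ℝ, 0 < s → s < t → t < 1 → (u : UnitAddCircle) = σ s →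
      (v : UnitAddCircle) = σ t → c < u → u < c + 1 → c < v → v < c + 1 → u < v) :
    ∃ φ : AutCircle, ∀ x, φ.1 x = σ x := by
  choose L hL h1 h2 using fun t : ℝ => CirclePi0.exists_lift_Ico (σ t) c
  have coe_inj : ∀ {s t : ℝ}, 0 ≤ s → s < 1 → 0 ≤ t → t < 1 → L s = L t → s = t := by
    intro s t hs0 hs1 ht0 ht1 e
    exact CirclePi0.eq_of_mem_Ico (σ.injective (by rw [← hL, ← hL, e])) hs0 (by linarith) ht0
      (by linarith)
  have hL0 : L 0 = c :=
    CirclePi0.eq_of_mem_Ico ((hL 0).trans hc.symm) (h1 0) (h2 0) le_rfl (by linarith)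
  have hLpos : ∀ t : ℝ, 0 < t → t < 1 → c < L t := fun t ht ht1 =>
    lt_of_le_of_ne (h1 t) fun e => ht.ne (coe_inj le_rfl zero_lt_one ht.le ht1 (hL0.trans e))
  have hmono : ∀ s t : ℝ, 0 ≤ s → s < t → t < 1 → L s < L t := by
    intro s t hs hst ht
    rcases hs.eq_or_lt with rfl | hs
    · rw [hL0]
      exact hLpos t hst ht
    · exact hσ s t _ _ hs hst ht (hL s) (hL t) (hLpos s hs (hst.trans ht)) (h2 s)
        (hLpos t (hs.trans hst) ht) (h2 t)
  have coe_fract : ∀ t : ℝ, ((Int.fract t : ℝ) : UnitAddCircle) = t := fun t => by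
    conv_rhs => rw [← Int.fract_add_floor t, coe_add_int]
  -- Extend the lift on `[0, 1)`, with values in `[c, c + 1)`, so that it commutes with integer
  -- translations.
  let f : ℝ → ℝ := fun t => L (Int.fract t) + ⌊t⌋
  have hf : ∀ t : ℝ, σ t = (f t : UnitAddCircle) := fun t => by
    rw [coe_add_int, hL, coe_fract]
  have hadd : ∀ (t : ℝ) (n : ℤ), f (t + n) = f t + n := fun t n => by
    change L (Int.fract (t + n)) + ((⌊t + n⌋ : ℤ) : ℝ) = L (Int.fract t) + ⌊t⌋ + n
    rw [Int.fract_add_intCast, Int.floor_add_intCast]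
    push_cast
    ring
  have hfm : StrictMono f := by
    intro s t hst
    change L (Int.fract s) + ⌊s⌋ < L (Int.fract t) + ⌊t⌋
    rcases (Int.floor_mono hst.le).eq_or_lt with e | e
    · rw [e]
      have h3 : Int.fract s < Int.fract t := by
        have h4 := Int.fract_add_floor s
        have h5 := Int.fract_add_floor t
        rw [e] at h4
        linarith
      have := hmono _ _ (Int.fract_nonneg s) h3 (Int.fract_lt_one t)
      linarith
    · have h3 : (⌊s⌋ : ℝ) + 1 ≤ ⌊t⌋ := by exact_mod_cast e
      linarith [h2 (Int.fract s), h1 (Int.fract t)]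
  -- Surjectivity of `σ` passes to the lift. A strictly increasing surjection of `ℝ` is a
  -- homeomorphism, which yields the continuity of `σ` and its inverse.
  have hfs : Function.Surjective f := by
    intro y
    obtain ⟨r, hr⟩ := exists_base (σ.symm y)
    have : (f r : UnitAddCircle) = y := by rw [← hf, hr, σ.apply_symm_apply]
    obtain ⟨n, hn⟩ := coe_eq_coe this
    exact ⟨r + n, by rw [hadd, hn]⟩
  let g : ℝ ≃o ℝ := hfm.orderIsoOfSurjective f hfs
  have hg : ∀ t : ℝ, σ t = (g t : UnitAddCircle) := hf
  have hg' : ∀ t : ℝ, σ.symm t = (g.symm t : UnitAddCircle) := fun t => by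
    rw [σ.symm_apply_eq, hg, g.apply_symm_apply]
  exact ⟨⟨{ toEquiv := σ
            continuous_toFun := continuous_of_lift g.continuous hg
            continuous_invFun := continuous_of_lift g.symm.continuous hg' }, g, hg⟩, fun _ => rfl⟩

end AutCircle

/-! ### Automorphisms of the cyclic realization. -/

namespace CirclePi0

open CirclePath DiagramRealization

/-- The action of `Aut S¹` on the system `F ↦ π₀(S¹ \ F)`. -/
noncomputable def action : Action circleDiagram AutCircle where
  rel φ F G := ∀ x, x ∉ G.1 → (φ⁻¹).1 x ∉ F.1
  mor {φ _ _} h := homMap φ⁻¹ h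
  exists_rel φ F := by
    classical
    refine ⟨⟨F.1.image φ.1, F.2.image _⟩, fun x hx hF =>
      hx (Finset.mem_image.2 ⟨_, hF, φ.1.apply_symm_apply x⟩)⟩
  rel_one h _ hx hF := hx (h hF)
  mor_one _ := rfl
  rel_mul {φ ψ F G H} h h' x hx := by
    rw [mul_inv_rev]
    exact h _ (h' x hx)
  mor_mul {φ ψ F G H} h h' := by
    have : ∀ χ : AutCircle, χ = φ⁻¹ * ψ⁻¹ → ∀ hχ : ∀ x, x ∉ H.1 → χ.1 x ∉ F.1,
        homMap ψ⁻¹ h' ≫ homMap φ⁻¹ h = homMap χ hχ := by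
      rintro _ rfl hχ
      exact isCyc.hom_ext (map_comp _ _ _ _ _)
    exact this _ (mul_inv_rev ψ φ) _

/-- The inverse of the equivalence `Λ → Λ_big`. -/
noncomputable abbrev skel : BigCyclicCategory ⥤ CyclicCategory :=
  cyclicInclusion.asEquivalence.inverse

/-- The one-point object of `Λ_big`. -/
noncomputable def unit : BigCyclicCategory :=
  ⟨circleSub.point, isCyc_circleSub _ fun _ _ _ => rfl⟩

/-- `f : π₀(S¹ \ F) → pt` jumps at `z`. -/
def JumpAt {F : CircleFinset} (f : obj F ⟶ unit) (z : UnitAddCircle) : Prop :=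
  Jump (proj F ≫ f.hom) z

/-- The point at which `f` jumps. -/
noncomputable def jumpPoint {F : CircleFinset} (f : obj F ⟶ unit) : UnitAddCircle :=
  (exists_jump (proj F ≫ f.hom)).choose

theorem jumpAt_jumpPoint {F : CircleFinset} (f : obj F ⟶ unit) : JumpAt f (jumpPoint f) :=
  (exists_jump (proj F ≫ f.hom)).choose_spec

theorem jumpPoint_eq_iff {F : CircleFinset} {f : obj F ⟶ unit} {z : UnitAddCircle} :
    jumpPoint f = z ↔ JumpAt f z :=
  ⟨fun e => e ▸ jumpAt_jumpPoint f, Jump.unique (jumpAt_jumpPoint f)⟩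

theorem Jump.map_comp {F G : CircleFinset} {k : cat F ⟶ circleSub.point} {z w : UnitAddCircle}
    (hz : Jump (proj F ≫ k) z) (ψ : AutCircle) (hψ : ∀ x, x ∉ G.1 → ψ.1 x ∉ F.1)
    (hw : ψ.1 w = z) : Jump (proj G ≫ map ψ hψ ≫ k) w := by
  rw [← Category.assoc, proj_comp_map, Category.assoc]
  exact Jump.puncturedMap_comp hz ψ hψ hw

theorem JumpAt.homMap_comp {F G : CircleFinset} {f : obj F ⟶ unit} {z w : UnitAddCircle}
    (hz : JumpAt f z) (ψ : AutCircle) (hψ : ∀ x, x ∉ G.1 → ψ.1 x ∉ F.1) (hw : ψ.1 w = z) :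
    JumpAt (homMap ψ hψ ≫ f) w := by
  exact Jump.map_comp hz ψ hψ hw

theorem jumpAt_transition {F G : CircleFinset} (h : F ≤ G) {f : obj F ⟶ unit} {z : UnitAddCircle}
    (hz : JumpAt f z) : JumpAt ((circleDiagram.map (homOfLE h)).unop ≫ f) z :=
  JumpAt.homMap_comp hz 1 (fun _ hx hF => hx (h hF)) rfl

/-- `threshold` as a morphism of `Λ_big`. -/
noncomputable def thresholdHom {F : CircleFinset} {z : UnitAddCircle} (hz : z ∈ F.1) :
    obj F ⟶ unit := isCyc.homMk (threshold hz)

theorem jumpAt_thresholdHom {F : CircleFinset} {z : UnitAddCircle} (hz : z ∈ F.1) :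
    JumpAt (thresholdHom hz) z := jump_threshold hz

theorem exists_ge_mem (F G : CircleFinset) (z : UnitAddCircle) :
    ∃ H : CircleFinset, F ≤ H ∧ G ≤ H ∧ z ∈ H.1 := by
  classical
  refine ⟨⟨F.1 ∪ G.1 ∪ {z}, ⟨z, by simp⟩⟩, ?_, ?_, by simp⟩
  · exact Finset.subset_union_left.trans Finset.subset_union_left
  · exact Finset.subset_union_right.trans Finset.subset_union_left

instance : IsDirectedOrder CircleFinset :=
  ⟨fun F G => let ⟨H, h1, h2, _⟩ := exists_ge_mem F G 0; ⟨H, h1, h2⟩⟩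

theorem el_eq_of_jumpAt {F G : CircleFinset} {f : obj F ⟶ unit} {g : obj G ⟶ unit}
    {z : UnitAddCircle} (hf : JumpAt f z) (hg : JumpAt g z) :
    el.{u} circleDiagram skel F f = el circleDiagram skel G g := by
  obtain ⟨H, hF, hG, hz⟩ := exists_ge_mem F G z
  refine (el_transition circleDiagram skel hF f).symm.trans
    (Eq.trans ?_ (el_transition circleDiagram skel hG g))
  exact congrArg _ (isCyc.hom_ext (proj_cancel
    (Jump.functor_eq (jumpAt_transition hF hf) (jumpAt_transition hG hg) hz)))

/-- If `v < u`, a path inside `(c, c + 1)` crosses `σ t` and then `σ s`, so its image under `h`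
crosses a lift of `t` and then a lift of `s`. As `0 < s < t < 1`, an integer lies between them; so
the image crosses `0` and the path crosses `σ 0`, which has no lift strictly between `c` and `c +
1`. -/
theorem lt_of_jump {F G : CircleFinset} {h : cat G ⟶ cat F} {σ : Equiv.Perm UnitAddCircle}
    (hG : ∀ z ∈ F.1, σ z ∈ G.1)
    (hj : ∀ (z : UnitAddCircle) (hz : z ∈ F.1), Jump (proj G ≫ h ≫ threshold hz) (σ z))
    {c s t u v : ℝ} (h0F : ((0 : ℝ) : UnitAddCircle) ∈ F.1) (hsF : (s : UnitAddCircle) ∈ F.1)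
    (htF : (t : UnitAddCircle) ∈ F.1) (hc : (c : UnitAddCircle) = σ ((0 : ℝ) : UnitAddCircle))
    (hs : 0 < s) (hst : s < t) (ht : t < 1)
    (hu : (u : UnitAddCircle) = σ s) (hv : (v : UnitAddCircle) = σ t)
    (hcu : c < u) (huc : u < c + 1) (hcv : c < v) : u < v := by
  by_contra hle
  have hne : v ≠ u := by
    rintro rfl
    obtain ⟨n, hn⟩ := coe_eq_coe (σ.injective (hu.symm.trans hv))
    have h1 : (0 : ℝ) < n := by linarith
    have h2 : (n : ℝ) < 1 := by linarith
    have h1' : 0 < n := by exact_mod_cast h1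
    have h2' : n < 1 := by exact_mod_cast h2
    omega
  have hvu : v < u := lt_of_le_of_ne (not_lt.1 hle) hne
  obtain ⟨a, ha1, ha2, ha⟩ := exists_between_notMem G hcv
  obtain ⟨b, hb1, hb2, hb⟩ := exists_between_notMem G hvu
  obtain ⟨d, hd1, hd2, hd⟩ := exists_between_notMem G huc
  obtain ⟨f, hf⟩ := exists_seg ha hb (by linarith)
  obtain ⟨g, hg⟩ := exists_seg hb hd (by linarith)
  obtain ⟨q, hq⟩ := exists_base (rep ((proj G ≫ h).functor.obj
    (ofReal ha))).1
  have hq' := (circleSub.coe_add_disp ((proj G ≫ h).functor.map f))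
  have hq' : ((q + circleSub.disp ((proj G ≫ h).functor.map f) : ℝ) : UnitAddCircle) =
      (rep ((proj G ≫ h).functor.obj
        (ofReal hb))).1 := by
    rw [AddCircle.coe_add, hq]
    exact hq'
  obtain ⟨t', ht', ht1, ht2⟩ := (crossing_iff htF (hG _ htF) (hj _ htF) f (a := a) rfl hq).1
    ⟨v, hv, ha2, by linarith⟩
  obtain ⟨s', hs', hs1, hs2⟩ := (crossing_iff hsF (hG _ hsF) (hj _ hsF) g (a := b) rfl hq').1
    ⟨u, hu, hb2, by linarith⟩
  obtain ⟨m, hm⟩ := coe_eq_coe ht'.symm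
  obtain ⟨k, hk⟩ := coe_eq_coe hs'.symm
  have hmk : m < k := by
    have : (m : ℝ) < k := by linarith
    exact_mod_cast this
  have hmk' : (m : ℝ) + 1 ≤ k := by exact_mod_cast hmk
  have hcomp : circleSub.disp ((proj G ≫ h).functor.map (f ≫ g)) =
      circleSub.disp ((proj G ≫ h).functor.map f) +
        circleSub.disp ((proj G ≫ h).functor.map g) := by
    rw [(proj G ≫ h).functor.map_comp]
    exact circleSub.disp_comp _ _
  -- The witness `m + 1` satisfies `t + m < m + 1 ≤ k < s + k`.
  obtain ⟨w, hw, hw1, hw2⟩ := (crossing_iff h0F (hG _ h0F) (hj _ h0F) (f ≫ g) (a := a) rfl hq).2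
    ⟨0 + ((m + 1 : ℤ) : ℝ), coe_add_int _ _, by push_cast; linarith, by
      rw [hcomp]
      push_cast
      linarith⟩
  rw [circleSub.disp_comp, hf, hg] at hw2
  obtain ⟨n, hn⟩ := coe_eq_coe (hc.trans hw.symm)
  have h1 : (0 : ℝ) < n := by linarith
  have h2 : (n : ℝ) < 1 := by linarith
  have h1' : 0 < n := by exact_mod_cast h1
  have h2' : n < 1 := by exact_mod_cast h2
  omega

theorem mk_eq_of_gap {F : CircleFinset} {x y : CircleCompl F} {a b t : ℝ}
    (ha : (a : UnitAddCircle) = x.1) (hb : (b : UnitAddCircle) = y.1) (hat : a < t) (hbt : b < t)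
    (hat' : ∀ s : ℝ, a < s → s < t → (s : UnitAddCircle) ∉ F.1)
    (hbt' : ∀ s : ℝ, b < s → s < t → (s : UnitAddCircle) ∉ F.1) :
    (x : CirclePi0 F) = y := by
  have key : ∀ {x y : CircleCompl F} {a b : ℝ} (_ : (a : UnitAddCircle) = x.1)
      (_ : (b : UnitAddCircle) = y.1) (_ : b < t)
      (_ : ∀ s : ℝ, a < s → s < t → (s : UnitAddCircle) ∉ F.1) (_ : a ≤ b),
      (x : CirclePi0 F) = y := by
    intro x y a b ha hb hbt hat' hab
    refine mk_eq_of_arc hab ha hb fun s hs => ?_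
    rcases hs.1.eq_or_lt with e | h
    · rw [← e, ha]
      exact x.2
    · exact hat' s h (hs.2.trans_lt hbt)
  rcases le_total a b with h | h
  · exact key ha hb hbt hat' h
  · exact (key hb ha hat hbt' h).symm

/-- Let `z` and `w` be the first two points of `F` met after `x`. A path from `x` to a point between
them crosses only `z` among the points of `F`, hence so does its image. Its image therefore starts
in the component just before `z`, which is that of `x`. -/
theorem obj_eq_of_jump {F G : CircleFinset} (hFG : F ≤ G) (hF : F.1.Nontrivial)
    {h : cat G ⟶ cat F}
    (hj : ∀ (z : UnitAddCircle) (hz : z ∈ F.1), Jump (proj G ≫ h ≫ threshold hz) z)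
    (x : CircleCompl G) :
    (proj G ≫ h).functor.obj x =
      comp (⟨x.1, fun hx => x.2 (hFG hx)⟩ : CircleCompl F) := by
  classical
  obtain ⟨a, ha⟩ := exists_base x.1
  choose l hl hl1 hl2 using fun z : UnitAddCircle => exists_lift_Ico z a
  have hla : ∀ z ∈ F.1, a < l z := fun z hz => lt_of_le_of_ne (hl1 z) fun e =>
    x.2 (hFG (by rw [← ha, e, hl]; exact hz))
  have hll : ∀ s : ℝ, a < s → s < a + 1 → l s = s := fun s h1 h2 =>
    eq_of_mem_Ico (hl _) (hl1 _) (hl2 _) h1.le h2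
  obtain ⟨z, hz, hmin⟩ := Finset.exists_min_image F.1 l F.2
  obtain ⟨w, hw, hmin'⟩ := Finset.exists_min_image (F.1.erase z) l (hF.erase_nonempty)
  obtain ⟨hwz, hwF⟩ := Finset.mem_erase.1 hw
  have hzw : l z < l w := lt_of_le_of_ne (hmin w hwF) fun e => hwz (by rw [← hl w, ← e, hl])
  obtain ⟨b, hb1, hb2, hb⟩ := exists_between_notMem G hzw
  have hbG : ((b : ℝ) : UnitAddCircle) ∉ G.1 := hb
  have hab : a < b := (hla z hz).trans hb1
  obtain ⟨f, hf⟩ := circleSub.exists_hom (p := fun x : CircleCompl G => (⟨x.1⟩ : OrientedCircle))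
    (i := x) (j := ofReal hbG) (d := b - a) (by linarith) (by
      change x.1 + ((b - a : ℝ) : UnitAddCircle) = b
      rw [← ha, ← AddCircle.coe_add, add_sub_cancel])
  obtain ⟨q₀, hq₀⟩ := exists_base (rep (F := F) ((proj G ≫ h).functor.obj x)).1
  obtain ⟨t', ht', h1, h2⟩ := (crossing_iff hz (hFG hz) (hj z hz) f ha hq₀).1
    ⟨l z, hl z, hla z hz, by linarith⟩
  obtain ⟨m, hm⟩ := coe_eq_coe (ht'.trans (hl z).symm)
  have hq : ((q₀ + m : ℝ) : UnitAddCircle) = (rep (F := F) ((proj G ≫ h).functor.obj x)).1 := by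
    rw [coe_add_int, hq₀]
  -- Shift the starting lift so that the crossed lift of `z` becomes `l z`.
  obtain ⟨q, rfl⟩ : ∃ q : ℝ, q₀ = q - m := ⟨q₀ + m, by ring⟩
  rw [sub_add_cancel] at hq
  have hno : ∀ u ∈ F.1, u ≠ z → ∀ s : ℝ, (s : UnitAddCircle) = u → q < s → s ≤ l z → False := by
    intro u hu huz s hs hs1 hs2
    obtain ⟨s', hs', h3, h4⟩ := (crossing_iff hu (hFG hu) (hj u hu) f ha hq).2
      ⟨s, hs, hs1, by linarith⟩
    have h5 := hll s' h3 (by linarith [hl2 w])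
    rw [hs'] at h5
    linarith [hmin' u (Finset.mem_erase.2 ⟨huz, hu⟩)]
  refine (mk_rep (F := F) _).symm.trans (mk_eq_of_gap (t := l z) hq ha (by linarith) (hla z hz)
    (fun s hs1 hs2 hsF => ?_) fun s hs1 hs2 hsF => ?_)
  · by_cases hsz : (s : UnitAddCircle) = z
    -- An earlier lift of `z` after `q` would leave room for a lift of `w` between `q` and `l z`.
    -- This needs a second point of `F`.
    · obtain ⟨r, hr, hr1, hr2⟩ := exists_lift_Ico w (l z - 1)
      obtain ⟨n, hn⟩ := coe_eq_coe (hsz.trans (hl z).symm)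
      have hn0 : (0 : ℝ) < n := by linarith
      have hn1 : (1 : ℝ) ≤ n := by
        have : 0 < n := by exact_mod_cast hn0
        exact_mod_cast this
      exact hno w hwF hwz r hr (by linarith) (by linarith)
    · exact hno _ hsF hsz s rfl hs1 hs2.le
  · have := hmin _ hsF
    rw [hll s hs1 (by linarith [hl2 z])] at this
    linarith

/-- The objects agree by `obj_eq_of_jump`. After a single threshold the functors agree because their
jumps do, and `functor_ext_comp` removes the threshold. -/
theorem eq_map_of_jump {F G : CircleFinset} (hFG : F ≤ G) (hF : F.1.Nontrivial)
    {h : cat G ⟶ cat F}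
    (hj : ∀ (z : UnitAddCircle) (hz : z ∈ F.1), Jump (proj G ≫ h ≫ threshold hz) z) :
    h = map 1 fun _ hx hx' => hx (hFG hx') := by
  obtain ⟨z, hz⟩ := F.2
  refine proj_cancel (circleSub.functor_ext_comp (threshold hz) (fun x => ?_) ?_)
  · rw [obj_eq_of_jump hFG hF hj x, proj_comp_map]
    rfl
  · rw [Category.assoc, Category.assoc]
    exact Jump.functor_eq (hj z hz) (Jump.map_comp (jump_threshold hz) 1 _ rfl) (hFG hz)

theorem exists_ge_nontrivial (F : CircleFinset) : ∃ G : CircleFinset, F ≤ G ∧ G.1.Nontrivial := by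
  classical
  obtain ⟨z, hz⟩ := F.2
  obtain ⟨w, hw⟩ := (inferInstance : Nonempty (CirclePi0 F)).map rep
  refine ⟨⟨insert w F.1, Finset.insert_nonempty _ _⟩, Finset.subset_insert _ _, w,
    Finset.mem_insert_self _ _, z, Finset.mem_insert_of_mem hz, fun e => hw (e ▸ hz)⟩

/-- The realization of the cyclic set represented by the one-point category is the circle, a class
being given by its jump. -/
theorem exists_equiv :
    ∃ E : (realization circleDiagram skel).obj (DiagramRealization.rep.{u} skel unit) ≃
        UnitAddCircle,
      ∀ (F : CircleFinset) (f : obj F ⟶ unit) (z : UnitAddCircle),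
        E (el circleDiagram skel F f) = z ↔ JumpAt f z := by
  obtain ⟨d, hd⟩ := exists_desc_el.{u} circleDiagram skel (b := unit)
    (fun F f => jumpPoint (F := F) f) (fun h f =>
      jumpPoint_eq_iff.2 (jumpAt_transition h (jumpAt_jumpPoint f)))
  refine ⟨Equiv.ofBijective d ⟨fun x y e => ?_, fun z => ?_⟩, fun F f z => ?_⟩
  · obtain ⟨F, f, rfl⟩ := exists_el _ _ x
    obtain ⟨G, g, rfl⟩ := exists_el _ _ y
    rw [hd, hd] at e
    exact el_eq_of_jumpAt (jumpPoint_eq_iff.1 e) (jumpAt_jumpPoint g)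
  · exact ⟨el circleDiagram skel ⟨{z}, Finset.singleton_nonempty z⟩
      (thresholdHom (Finset.mem_singleton_self z)),
      (hd _ _).trans (jumpPoint_eq_iff.2 (jumpAt_thresholdHom _))⟩
  · exact (Eq.congr_left (hd F f)).trans jumpPoint_eq_iff

section

variable {E : (realization circleDiagram skel).obj (DiagramRealization.rep.{u} skel unit) ≃
  UnitAddCircle}

theorem jump_comp_threshold
    (hE : ∀ (F : CircleFinset) (f : obj F ⟶ unit) (z : UnitAddCircle),
      E (el circleDiagram skel F f) = z ↔ JumpAt f z)
    {α : Aut (realization.{u} circleDiagram skel)} {F G : CircleFinset} {h : obj G ⟶ obj F}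
    (e : α.hom.app _ (el circleDiagram skel F (𝟙 _)) = el circleDiagram skel G h)
    {z : UnitAddCircle} (hz : z ∈ F.1) :
    Jump (proj G ≫ h.hom ≫ threshold hz) (perm E α z) := by
  refine (hE G (h ≫ thresholdHom hz) _).1 ((perm_el E α e (thresholdHom hz)).symm.trans ?_)
  exact congrArg (perm E α) ((hE F _ z).2 (jumpAt_thresholdHom hz))

/-- `G` is enlarged to contain `F`, for comparison with the canonical functor, and the image of `F`,
as `crossing_iff` requires. -/
theorem exists_image_generic
    (hE : ∀ (F : CircleFinset) (f : obj F ⟶ unit) (z : UnitAddCircle),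
      E (el circleDiagram skel F f) = z ↔ JumpAt f z)
    (α : Aut (realization.{u} circleDiagram skel)) (F : CircleFinset) :
    ∃ (G : CircleFinset) (h : cat G ⟶ cat F), F ≤ G ∧
      α.hom.app _ (el circleDiagram skel F (𝟙 _)) =
        el circleDiagram skel G (show obj G ⟶ obj F from isCyc.homMk h) ∧
      (∀ z ∈ F.1, perm E α z ∈ G.1) ∧
      ∀ (z : UnitAddCircle) (hz : z ∈ F.1),
        Jump (proj G ≫ h ≫ threshold hz) (perm E α z) := by
  classical
  obtain ⟨G, hG, h, e⟩ := exists_el_ge circleDiagram skel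
    (⟨F.1 ∪ F.1.image (perm E α), F.2.mono Finset.subset_union_left⟩ : CircleFinset)
    (α.hom.app _ (el circleDiagram skel F (𝟙 _)))
  exact ⟨G, h.hom, Finset.subset_union_left.trans hG, e.symm,
    fun z hz => hG (Finset.mem_union_right _ (Finset.mem_image_of_mem _ hz)),
    fun z hz => jump_comp_threshold hE e.symm hz⟩

theorem perm_cyclic
    (hE : ∀ (F : CircleFinset) (f : obj F ⟶ unit) (z : UnitAddCircle),
      E (el circleDiagram skel F f) = z ↔ JumpAt f z)
    (α : Aut (realization.{u} circleDiagram skel)) (c : ℝ)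
    (hc : (c : UnitAddCircle) = perm E α 0) (s t u v : ℝ) (hs : 0 < s) (hst : s < t) (ht : t < 1)
    (hu : (u : UnitAddCircle) = perm E α s) (hv : (v : UnitAddCircle) = perm E α t)
    (hcu : c < u) (huc : u < c + 1) (hcv : c < v) (_ : v < c + 1) : u < v := by
  classical
  obtain ⟨G, h, -, -, hG, hj⟩ := exists_image_generic hE α
    (⟨{((0 : ℝ) : UnitAddCircle), (s : UnitAddCircle), (t : UnitAddCircle)}, by simp⟩ :
      CircleFinset)
  exact lt_of_jump hG hj (by simp) (by simp) (by simp) hc hs hst ht hu hv hcu huc hcv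

theorem eq_one_of_perm
    (hE : ∀ (F : CircleFinset) (f : obj F ⟶ unit) (z : UnitAddCircle),
      E (el circleDiagram skel F f) = z ↔ JumpAt f z)
    {α : Aut (realization.{u} circleDiagram skel)} (hα : perm E α = 1) : α = 1 := by
  refine aut_ext fun F₀ => ?_
  -- Sets with at least two points are cofinal, which is all that `aut_ext` asks for.
  obtain ⟨F, hF₀, hF⟩ := exists_ge_nontrivial F₀
  refine ⟨F, hF₀, ?_⟩
  obtain ⟨G, h, hFG, e, -, hj⟩ := exists_image_generic hE α F
  rw [hα] at hj
  refine e.trans (Eq.trans ?_ (el_transition circleDiagram skel hFG (𝟙 _)))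
  rw [Category.comp_id]
  exact congrArg _ (isCyc.hom_ext (eq_map_of_jump hFG hF hj))

end

theorem toAut_bijective : Function.Bijective (action.toAut.{u} skel) := by
  obtain ⟨E, hE⟩ := exists_equiv.{u}
  refine action.toAut_bijective skel E (fun φ => φ.1.toEquiv) (fun φ ψ h => ?_) (fun φ x => ?_)
    (fun α => ?_) fun α => eq_one_of_perm hE
  · exact Subtype.ext (Homeomorph.ext fun x => Equiv.congr_fun h x)
  · obtain ⟨F, f, rfl⟩ := exists_el _ _ x
    obtain ⟨G, hG⟩ := action.exists_rel φ F
    rw [action.act_el skel hG]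
    exact (hE _ _ _).2 (JumpAt.homMap_comp ((hE _ _ _).1 rfl) φ⁻¹ hG (φ.1.symm_apply_apply _))
  · obtain ⟨c, hc⟩ := exists_base (perm E α 0)
    obtain ⟨φ, hφ⟩ := AutCircle.exists_of_cyclic (perm E α) c hc (perm_cyclic hE α c hc)
    exact ⟨φ, Equiv.ext fun x => (hφ x).symm⟩

end CirclePi0

theorem exists_autCircle_mulEquiv_aut : ∃ e : AutCircle ≃* Aut CyclicSet.setRealization.{u},
    ∀ (φ : AutCircle) (X : CyclicSet.{u}) (F G : CircleFinset)
      (h : ∀ x, x ∉ G.1 → (φ⁻¹).1 x ∉ F.1)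
      (ξ : X.extend.obj (Opposite.op (CirclePi0.obj F))),
      (e φ).hom.app X (CyclicSet.setRealizationι X F ξ) =
        CyclicSet.setRealizationι X G (X.extend.map (CirclePi0.homMap φ⁻¹ h).op ξ) :=
  ⟨MulEquiv.ofBijective (CirclePi0.action.toAut CirclePi0.skel) CirclePi0.toAut_bijective,
    fun _ X _ _ h ξ => CirclePi0.action.act_ι CirclePi0.skel X h ξ⟩

theorem mainTheorem5 :
    (∃ e : AutI ≃* Aut SSet.setRealization.{u},
      ∀ (φ : AutI) (X : SSet.{u}) (F G : Finset unitInterval) (h : ∀ x, x ∉ G → (φ⁻¹).1 x ∉ F)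
        (ξ : X.extend.obj (Opposite.op (IntervalPi0.obj F))),
        (e φ).hom.app X (SSet.setRealizationι X F ξ) =
          SSet.setRealizationι X G (X.extend.map (IntervalPi0.map φ⁻¹ h).op ξ)) ∧
    (∃ r : AutI ≃* (unitInterval ≃o unitInterval),
      ∀ (φ : AutI) (x : unitInterval), r φ x = φ.1 x) ∧
    (∃ e : AutCircle ≃* Aut CyclicSet.setRealization.{u},
      ∀ (φ : AutCircle) (X : CyclicSet.{u}) (F G : CircleFinset)
        (h : ∀ x, x ∉ G.1 → (φ⁻¹).1 x ∉ F.1)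
        (ξ : X.extend.obj (Opposite.op (CirclePi0.obj F))),
        (e φ).hom.app X (CyclicSet.setRealizationι X F ξ) =
          CyclicSet.setRealizationι X G
            (X.extend.map (CirclePi0.homMap φ⁻¹ h).op ξ)) :=
  ⟨exists_autI_mulEquiv_aut, exists_autI_mulEquiv, exists_autCircle_mulEquiv_aut⟩
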